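/- **Conventions.** Points $t$ with prescribed argument lie on the universal covering of $\mathbb C\setminus\{0\}$, and powers of $t$ are taken there. $D_r=\{|z|<r\}$; $S_d(\alpha)$ is the open sector in direction $d$ with opening $\alpha$, $S_d(\alpha,r)$ its part with $|t|<r$; $\mathcal L_d$ is the ray in direction $d$. $\mathcal O^k(U)$ denotes the functions holomorphic on $U$ that satisfy $|f(s)|\le C_1e^{C_2|s|^k}$ on every closed subsector contained in $U$. A formal series $\hat f=\sum f_nt^n$ is 1-summable in direction $d$ if $g(s)=\sum f_n\frac{n!}{(2n)!}s^n$ converges near $0$ and continues to a function in $\mathcal O^1(D_\varrho\cup S_d(\epsilon))$ for some $\epsilon,\varrho>0$; its 1-sum is $f^d(t)=t^{-1/2}\int_{e^{id}\mathbb R_+}g(s)\,C_2\big((s/t)^{1/2}\big)\,ds^{1/2}$ with the Ecalle kernel $C_2(\tau)=\sum_n\frac{(-\tau)^n}{n!\,\Gamma(1-\frac{n+1}2)}$. $\mathcal L_d$ is a Stokes line if $\hat f$ is 1-summable in all directions but finitely many modulo $2\pi$, and $d$ is one of the exceptions. A hyperfunction $[g]_d$ is the class of $g\in\mathcal O^2\big(D_\varrho\cup(S_\theta(\alpha)\setminus\mathcal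 L_d)\big)$ modulo $\mathcal O^2\big(D_\varrho\cup S_\theta(\alpha)\big)$; it acts on functions $\psi$ by $[g]_d[\psi]=\int_\gamma g\psi\,ds$, where $\gamma$ comes in from infinity along $\mathcal L_{d^-}$ to $0$ and goes out along $\mathcal L_{d^+}$, with $d^-<d<d^+$ in the sector and $g$ a defining function for which the integrals converge. On a ray through $c$, $\delta^{(m)}(s-c)$ is the class of $\frac{d^m}{ds^m}\frac{-1}{2\pi i(s-c)}$. **Theorem.** Let $z_0\ne0$, let $\theta$ be a value of $\arg z_0$, and let $\delta=2\theta$ (a direction, not to be confused with the Dirac function). Let $\varphi$ be a (single-valued) holomorphic function on $\mathbb C\setminus\{z_0\}$ with $$\varphi(z)=\sum_{n\ge1}\frac{a_n}{(z-z_0)^n}+\phi(z),\qquad \limsup_{n\to\infty}|a_n|^{1/n}<1,\qquad \phi\in\mathcal O^2(\mathbb C),$$ where the expansion is required for $|z-z_0|\ge1$. Let $\hat u(t,z)=\sum_n u_n(z)t^n$, with $u_n$ holomorphic on $D_R$, $R>0$, be the formal solution of $\partial_tu=\partial_z^2u$, $u(0,z)=\varphi(z)$. For $|z|<|z_0|$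 let $\theta_z$ be the value of $\arg(z_0-z)$ that is continuous in $z$ and equal to $\theta$ at $z=0$. 1. If some $a_n\neq0$ ($n\ge1$), then for every $z$ with $|z|<\min(R,|z_0|)$ the line $\mathcal L_{2\theta_z}$ is a Stokes line of $\hat u(\cdot,z)$; for $z=0$ this is $\mathcal L_\delta$. 2. Let $0<\alpha<\pi$ and $0<\varrho<|z_0|$. For all $z$ in a sufficiently small disc around $0$ the point $z_0-z$ lies in $S_\theta(\alpha)$, and the hyperfunction $F_z(s)=[\varphi(s+z)+\varphi(z-s)]_{\theta_z}$ satisfies $$F_z(s)=[\varphi(s+z)]_{\theta_z}=\Big[\sum_{n\ge1}\frac{a_n}{(z+s-z_0)^n}\Big]_{\theta_z}=-2\pi i\sum_{n\ge1}\frac{a_n(-1)^{n-1}}{(n-1)!}\,\delta^{(n-1)}(z+s-z_0).$$ The last series converges locally uniformly on the level of the standard defining functions, and also as analytic functionals: for every $\psi$ holomorphic and exponentially decreasing of order 2 (on closed subsectors) on $D_\varrho\cup S_\theta(\alpha)$ one has $\delta^{(m)}(z+s-z_0)[\psi]=(-1)^m\psi^{(m)}(z_0-z)$, and the values of the terms at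 $\psi$ sum to $F_z[\psi]$. 3. For every $\varepsilon\in(0,\pi)$ there is $\eta>0$ such that for all $0<\alpha\le\varepsilon/2$, $0<\varrho<|z_0|$, $\delta^+\in(\delta,\delta+\eta)$ and $\delta^-\in(\delta-\eta,\delta)$ there is $r>0$ such that for all $z\in D_r$: $z_0-z\in S_\theta(\alpha)$, the series $\hat u(\cdot,z)$ is 1-summable in the directions $\delta^\pm$, and for all $t\in S_\delta(\pi-\varepsilon,r)$ the integrals defining the 1-sums $u^{\delta^\pm}(t,z)$ converge absolutely and $$u^{\delta^+}(t,z)-u^{\delta^-}(t,z)=F_z(s)\Big[\tfrac1{\sqrt{4\pi t}}e^{-s^2/4t}\Big]=-i\sqrt{\frac{\pi}{t}}\sum_{n=1}^\infty\frac{a_n}{(n-1)!}\,\frac{d^{n-1}}{ds^{n-1}}e^{-s^2/4t}\Big|_{s=z_0-z},$$ where the last series converges. -/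

import Mathlib

open Filter Topology MeasureTheory Set

noncomputable section

/-! ### Sectors and exponential growth -/

/-- The complex number `r e^{i x}`. The pair `(r, x)` with `0 < r` is a point of the universal
covering of `ℂ ∖ {0}`, and `polar r x` is its projection. -/
def polar (r x : ℝ) : ℂ := (r : ℂ) * Complex.exp (Complex.I * (x : ℂ))

/-- The unbounded sector in direction `d` with opening `α`. -/
def sector (d α : ℝ) : Set ℂ :=
  {s | ∃ r x : ℝ, 0 < r ∧ d - α / 2 < x ∧ x < d + α / 2 ∧ s = polar r x}

/-- The open half-line from `0` in direction `d`. -/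
def ray (d : ℝ) : Set ℂ := {s | ∃ r : ℝ, 0 < r ∧ s = polar r d}

/-- A sector together with the disc of radius `ρ`. -/
def hatSector (d α ρ : ℝ) : Set ℂ := Metric.ball 0 ρ ∪ sector d α

/-- The disc of radius `ρ` together with the sector in direction `θ` with opening `α`, slit along
the half-line in direction `d`. -/
def slitSector (θ α ρ d : ℝ) : Set ℂ := Metric.ball 0 ρ ∪ (sector θ α \ ray d)

/-- The closed infinite sector of directions `β₁ ≤ x ≤ β₂` (without its vertex) lies in `U`. -/
def ClosedSubsector (U : Set ℂ) (β₁ β₂ : ℝ) : Prop :=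
  ∀ r x : ℝ, 0 < r → β₁ ≤ x → x ≤ β₂ → polar r x ∈ U

/-- Holomorphic on `U` and of exponential growth of order at most `k` there: on every closed
subsector contained in `U` there is a bound `C₁ exp (C₂ |s| ^ k)`. For `U = ℂ` this is a global
bound, because `ℂ ∖ {0}` is itself such a subsector. -/
def ExpGrowth (k : ℝ) (U : Set ℂ) (f : ℂ → ℂ) : Prop :=
  DifferentiableOn ℂ f U ∧
    ∀ β₁ β₂ : ℝ, ClosedSubsector U β₁ β₂ →
      ∃ C₁ C₂ : ℝ, 0 < C₁ ∧ 0 < C₂ ∧ ∀ r x : ℝ, 0 < r → β₁ ≤ x → x ≤ β₂ →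
        ‖f (polar r x)‖ ≤ C₁ * Real.exp (C₂ * r ^ k)

/-- Holomorphic on `U` and exponentially decreasing of order `k`: on every closed subsector
contained in `U` there is a bound `C₁ exp (-C₂ |s| ^ k)` with `C₂ > 0`. -/
def ExpDecay (k : ℝ) (U : Set ℂ) (f : ℂ → ℂ) : Prop :=
  DifferentiableOn ℂ f U ∧
    ∀ β₁ β₂ : ℝ, ClosedSubsector U β₁ β₂ →
      ∃ C₁ C₂ : ℝ, 0 < C₁ ∧ 0 < C₂ ∧ ∀ r x : ℝ, 0 < r → β₁ ≤ x → x ≤ β₂ →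
        ‖f (polar r x)‖ ≤ C₁ * Real.exp (-(C₂ * r ^ k))

/-! ### Summability -/

/-- The Ecalle kernel `C_α(τ) = ∑ (-τ)^n / (n! Γ(1 - (n+1)/α))`. At the poles of `Γ` Mathlib has
`Γ = 0` and `x / 0 = 0`, which agrees with the usual reading `1 / Γ = 0`. -/
def ecalleKernel (α : ℝ) (τ : ℂ) : ℂ :=
  ∑' n : ℕ, (-τ) ^ n / ((n.factorial : ℂ) * (Real.Gamma (1 - ((n : ℝ) + 1) / α) : ℂ))

/-- Integrand of the acceleration operator in direction `d` at the point `(r, ψ)` (that is,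
`t = r e^{iψ}`) of the universal covering, with `s = x e^{id}` parametrized by `x > 0`:
`g(s) C_{k₁/k₂}((s/t)^{k₂}) d(s^{k₂})/dx`, all powers being taken on the universal covering. -/
def accelIntegrand (k₁ k₂ d : ℝ) (g : ℂ → ℂ) (r ψ x : ℝ) : ℂ :=
  g (polar x d) * ecalleKernel (k₁ / k₂) (polar ((x / r) ^ k₂) (k₂ * (d - ψ))) *
    ((k₂ : ℂ) * polar (x ^ (k₂ - 1)) (k₂ * d))

/-- The acceleration operator `t^{-k₂} ∫ g(s) C_{k₁/k₂}((s/t)^{k₂}) d(s^{k₂})` in direction `d`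
with indices `k₁ > k₂`, at `t = r e^{iψ}` on the universal covering. -/
def acceleration (k₁ k₂ d : ℝ) (g : ℂ → ℂ) (r ψ : ℝ) : ℂ :=
  (polar (r ^ k₂) (k₂ * ψ))⁻¹ * ∫ x in Ioi (0 : ℝ), accelIntegrand k₁ k₂ d g r ψ x

/-- The formal deceleration operator with indices `k₁` and `k₂`. -/
def formalDeceleration (k₁ k₂ : ℝ) (f : PowerSeries ℂ) : PowerSeries ℂ :=
  PowerSeries.mk fun n => PowerSeries.coeff n f *
    ((Real.Gamma (1 + (n : ℝ) / k₁) / Real.Gamma (1 + (n : ℝ) / k₂) : ℝ) : ℂ)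

/-- The decelerated series of `f` converges near `0` and its sum `g` continues to a function of
exponential growth of order at most `k` in some sector in direction `d` together with a disc. -/
def IsContinuedDeceleration (k d : ℝ) (f : PowerSeries ℂ) (g : ℂ → ℂ) : Prop :=
  ∃ ε ρ : ℝ, 0 < ε ∧ 0 < ρ ∧ ExpGrowth k (hatSector d ε ρ) g ∧
    ∀ s ∈ Metric.ball (0 : ℂ) ρ,
      HasSum (fun n : ℕ => PowerSeries.coeff n (formalDeceleration 1 (k / (k + 1)) f) * s ^ n) (g s)

/-- `f` is `k`-summable in the direction `d`. -/
def KSummable (k d : ℝ) (f : PowerSeries ℂ) : Prop :=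
  ∃ g : ℂ → ℂ, IsContinuedDeceleration k d f g

open Classical in
/-- The continued decelerated series; on the sector and disc in question it is unique. -/
def continuedDeceleration (k d : ℝ) (f : PowerSeries ℂ) : ℂ → ℂ :=
  if h : KSummable k d f then h.choose else 0

/-- The integral that defines the `k`-sum of `f` in direction `d` at `(r, ψ)` converges. -/
def KSumConverges (k d : ℝ) (f : PowerSeries ℂ) (r ψ : ℝ) : Prop :=
  IntegrableOn (accelIntegrand 1 (k / (k + 1)) d (continuedDeceleration k d f) r ψ) (Ioi 0)

/-- The `k`-sum of `f` in the direction `d` at the point `(r, ψ)` of the universal covering. -/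
def kSum (k d : ℝ) (f : PowerSeries ℂ) (r ψ : ℝ) : ℂ :=
  acceleration 1 (k / (k + 1)) d (continuedDeceleration k d f) r ψ

/-- `f` is `k`-summable in all but finitely many directions modulo `2π`, and `d` is one of the
exceptional (singular) directions. -/
def IsStokesLine (k d : ℝ) (f : PowerSeries ℂ) : Prop :=
  {β : Real.Angle | ∃ x : ℝ, (x : Real.Angle) = β ∧ ¬ KSummable k x f}.Finite ∧ ¬ KSummable k d f

/-! ### Laplace type hyperfunctions -/

/-- The space of functions holomorphic of exponential growth of order at most `k` on `U`. -/
def expGrowthSpace (k : ℝ) (U : Set ℂ) : Submodule ℂ (ℂ → ℂ) where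
  carrier := {f | ExpGrowth k U f}
  zero_mem' := ⟨differentiableOn_const 0, fun _ _ _ =>
    ⟨1, 1, one_pos, one_pos, fun r x _ _ _ => by simp; positivity⟩⟩
  add_mem' := by
    rintro f g ⟨hf, hf'⟩ ⟨hg, hg'⟩
    refine ⟨hf.add hg, fun β₁ β₂ h => ?_⟩
    obtain ⟨A, B, hA, hB, hAB⟩ := hf' β₁ β₂ h
    obtain ⟨A', B', hA', hB', hAB'⟩ := hg' β₁ β₂ h
    refine ⟨A + A', B + B', by positivity, by positivity, fun r x hr h1 h2 => ?_⟩
    have hk : 0 ≤ r ^ k := Real.rpow_nonneg hr.le k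
    have e1 : Real.exp (B * r ^ k) ≤ Real.exp ((B + B') * r ^ k) := by
      apply Real.exp_le_exp.2; nlinarith
    have e2 : Real.exp (B' * r ^ k) ≤ Real.exp ((B + B') * r ^ k) := by
      apply Real.exp_le_exp.2; nlinarith
    calc ‖(f + g) (polar r x)‖ ≤ ‖f (polar r x)‖ + ‖g (polar r x)‖ := norm_add_le _ _
      _ ≤ A * Real.exp (B * r ^ k) + A' * Real.exp (B' * r ^ k) :=
        add_le_add (hAB r x hr h1 h2) (hAB' r x hr h1 h2)
      _ ≤ A * Real.exp ((B + B') * r ^ k) + A' * Real.exp ((B + B') * r ^ k) := by gcongr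
      _ = _ := by ring
  smul_mem' := by
    rintro c f ⟨hf, hf'⟩
    refine ⟨hf.const_smul c, fun β₁ β₂ h => ?_⟩
    obtain ⟨A, B, hA, hB, hAB⟩ := hf' β₁ β₂ h
    refine ⟨(‖c‖ + 1) * A, B, by positivity, hB, fun r x hr h1 h2 => ?_⟩
    have := hAB r x hr h1 h2
    calc ‖(c • f) (polar r x)‖ = ‖c‖ * ‖f (polar r x)‖ := by simp
      _ ≤ (‖c‖ + 1) * (A * Real.exp (B * r ^ k)) := by gcongr; linarith
      _ = _ := by ring

/-- Inside the functions on the slit domain, those that extend across the slit (on the slit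
domain they agree with a function of the same growth on the unslit domain). -/
def extendable (k θ α ρ d : ℝ) : Submodule ℂ (expGrowthSpace k (slitSector θ α ρ d)) where
  carrier := {g | ∃ h ∈ expGrowthSpace k (hatSector θ α ρ), EqOn g.1 h (slitSector θ α ρ d)}
  zero_mem' := ⟨0, Submodule.zero_mem _, fun _ _ => rfl⟩
  add_mem' := by
    rintro f g ⟨h, hh, e⟩ ⟨h', hh', e'⟩
    exact ⟨h + h', Submodule.add_mem _ hh hh', fun s hs => congrArg₂ (· + ·) (e hs) (e' hs)⟩
  smul_mem' := by
    rintro c f ⟨h, hh, e⟩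
    exact ⟨c • h, Submodule.smul_mem _ c hh, fun s hs => congrArg (c • ·) (e hs)⟩

/-- Laplace type hyperfunctions of exponential growth of order `k`, supported by the half-line in
direction `d` inside the sector in direction `θ` with opening `α` (and the disc of radius `ρ`):
functions on the slit domain modulo functions on the unslit domain. -/
abbrev LaplaceHyperfunction (k θ α ρ d : ℝ) : Type :=
  ↥(expGrowthSpace k (slitSector θ α ρ d)) ⧸ extendable k θ α ρ d

/-- `g` is a defining function of the hyperfunction `G`, i.e. `G = [g]_d`. -/
def IsDefiningFunction {k θ α ρ d : ℝ} (G : LaplaceHyperfunction k θ α ρ d) (g : ℂ → ℂ) : Prop :=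
  ∃ h : g ∈ expGrowthSpace k (slitSector θ α ρ d),
    (Submodule.Quotient.mk ⟨g, h⟩ : LaplaceHyperfunction k θ α ρ d) = G

/-- The integral of `f` along the half-line from `0` to infinity in direction `x`. -/
def rayIntegral (f : ℂ → ℂ) (x : ℝ) : ℂ :=
  ∫ r in Ioi (0 : ℝ), f (polar r x) * Complex.exp (Complex.I * (x : ℂ))

/-- The value `G[ψ]` of the hyperfunction `G`, as an analytic functional, is `v`: for a defining
function `g` of `G` the integral of `g ψ` along the path that comes in from infinity in direction
`dm` and goes out to infinity in direction `dp` converges and equals `v`, for all directions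
`dm < d < dp` in the sector. -/
def HasPairing {k θ α ρ d : ℝ} (G : LaplaceHyperfunction k θ α ρ d) (ψ : ℂ → ℂ) (v : ℂ) : Prop :=
  ∃ g : ℂ → ℂ, IsDefiningFunction G g ∧
    ∀ dm dp : ℝ, θ - α / 2 < dm → dm < d → d < dp → dp < θ + α / 2 →
      IntegrableOn (fun r : ℝ => g (polar r dm) * ψ (polar r dm)) (Ioi 0) ∧
      IntegrableOn (fun r : ℝ => g (polar r dp) * ψ (polar r dp)) (Ioi 0) ∧
      rayIntegral (fun s => g s * ψ s) dp - rayIntegral (fun s => g s * ψ s) dm = v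

/-- The standard defining function of the `m`-th derivative of the Dirac function at `c`: the
`m`-th derivative of `-1 / (2πi (s - c))`. -/
def diracFunction (m : ℕ) (c : ℂ) : ℂ → ℂ :=
  iteratedDeriv m fun s : ℂ => -1 / (2 * (Real.pi : ℂ) * Complex.I * (s - c))

/-! ### The heat equation -/

/-- `∑ u n z * t ^ n` is the formal power series solution, with coefficients holomorphic on the
disc of radius `R`, of `∂ₜ u = ∂_z² u`, `u(0, z) = φ z`. -/
def IsFormalHeatSolution (φ : ℂ → ℂ) (R : ℝ) (u : ℕ → ℂ → ℂ) : Prop :=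
  (∀ n : ℕ, DifferentiableOn ℂ (u n) (Metric.ball 0 R)) ∧
  (∀ z ∈ Metric.ball (0 : ℂ) R, u 0 z = φ z) ∧
  ∀ n : ℕ, ∀ z ∈ Metric.ball (0 : ℂ) R, ((n : ℂ) + 1) * u (n + 1) z = iteratedDeriv 2 (u n) z

/-- The formal power series in `t` obtained by fixing `z`. -/
def seriesAt (u : ℕ → ℂ → ℂ) (z : ℂ) : PowerSeries ℂ := PowerSeries.mk fun n => u n z

/-- The function `s ↦ exp (-s² / (4t)) / √(4πt)` for `t = r e^{iψ}` on the universal covering,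
where `√t = √r e^{iψ/2}`. -/
def heatKernel (r ψ : ℝ) (s : ℂ) : ℂ :=
  1 / ((Real.sqrt (4 * Real.pi) : ℂ) * polar (Real.sqrt r) (ψ / 2)) *
    Complex.exp (-s ^ 2 / (4 * polar r ψ))

/-- The argument of `z₀ - z` continued from the value `θ` at `z = 0` (for `|z| < |z₀|`). -/
def argAt (z₀ : ℂ) (θ : ℝ) (z : ℂ) : ℝ := θ + Complex.arg ((z₀ - z) / z₀)

end

noncomputable section

/-! ### Polar coordinates -/

/-! Fix `z`, put `f(w) = φ(z + w)` and `p = z₀ - z`. The function `f` is a principal part at `p`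
plus an entire function `Q` of order at most 2 (`HasPole`, `exists_hasPole`). The principal part
converges on all of `ℂ ∖ {p}`, because in the coordinate `1/(w - p)` it is an entire function
(`hasSum_principalPart`).

The heat equation gives the coefficients `f⁽²ⁿ⁾(0)/n!`. The factor `n!/(2n)!` turns them into the
even Taylor coefficients of `f`, so the decelerated series sums to `g(s) = (f(√s) + f(-√s))/2`. This
is holomorphic off `p²` and of order 1 in `s`. Hence every direction other than that of `p²`, which
is twice that of `p`, is nonsingular (`HasPole.isContinuedDeceleration`). If that direction were
nonsingular too, `g` would continue to `p²`, the principal part would be bounded near `p`, and by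
Liouville it would vanish (`HasPole.eq_zero_of_kSummable`).

The kernel of index 2 is `exp(-τ²/4)/√π` (`ecalleKernel_two`). With `s = w²` the 1-sum in direction
`d` becomes the integral of `f(w) + f(-w)` against the heat kernel along the ray in direction `d/2`
(`kSum_eq_rayIntegral`). Between two directions on either side of the singular one, `Q(w) + f(-w)`
is holomorphic and is dominated by the decay of the kernel for small `t`, so its ray integral does
not change (`rayIntegral_eq_of_differentiableAt`). Only the principal part jumps.

The jump of a principal part against a decaying function is a residue computation on an unbounded
contour: `jump_cauchy` treats a simple pole, `jump_pow` differentiates in the position of the pole,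
`jump_principalPart` sums over the orders. The same computation evaluates the hyperfunction, because
`φ(z - s)` and the entire part extend across the slit (`HasPole.exists_hyperfunction`). The jump of
the 1-sums and the value of the hyperfunction at the heat kernel are therefore sums of one and the
same series. -/

lemma norm_polar {r : ℝ} (hr : 0 ≤ r) (x : ℝ) : ‖polar r x‖ = r := by
  rw [polar, norm_mul, mul_comm Complex.I, Complex.norm_exp_ofReal_mul_I, mul_one,
    Complex.norm_real, Real.norm_of_nonneg hr]

lemma polar_zero (x : ℝ) : polar 0 x = 0 := by simp [polar]

lemma polar_ne_zero {r : ℝ} (hr : 0 < r) (x : ℝ) : polar r x ≠ 0 := by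
  rw [← norm_pos_iff, norm_polar hr.le]; exact hr

lemma polar_mul (r s x y : ℝ) : polar r x * polar s y = polar (r * s) (x + y) := by
  simp only [polar, Complex.ofReal_mul, Complex.ofReal_add, mul_add, Complex.exp_add]; ring

lemma polar_sq (r x : ℝ) : polar r x ^ 2 = polar (r ^ 2) (2 * x) := by
  rw [sq, polar_mul, ← sq, two_mul]

lemma polar_add_pi (r x : ℝ) : polar r (x + Real.pi) = -polar r x := by
  simp only [polar, Complex.ofReal_add, mul_add, Complex.exp_add, mul_comm Complex.I (Real.pi : ℂ),
    Complex.exp_pi_mul_I]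
  ring

lemma polar_eq_exp {r : ℝ} (hr : 0 < r) (x : ℝ) :
    polar r x = Complex.exp ((Real.log r : ℝ) + (x : ℂ) * Complex.I) := by
  rw [polar, Complex.exp_add, ← Complex.ofReal_exp, Real.exp_log hr, mul_comm Complex.I]

lemma exp_eq_polar (w : ℂ) : Complex.exp w = polar (Real.exp w.re) w.im := by
  conv_lhs => rw [← Complex.re_add_im w, Complex.exp_add]
  rw [polar, Complex.ofReal_exp, mul_comm Complex.I]

lemma polar_re (r x : ℝ) : (polar r x).re = r * Real.cos x := by
  rw [polar, mul_comm Complex.I, Complex.re_ofReal_mul, Complex.exp_ofReal_mul_I_re]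

lemma polar_im (r x : ℝ) : (polar r x).im = r * Real.sin x := by
  rw [polar, mul_comm Complex.I, Complex.im_ofReal_mul, Complex.exp_ofReal_mul_I_im]

@[fun_prop]
lemma continuous_polar : Continuous fun q : ℝ × ℝ => polar q.1 q.2 := by
  unfold polar; fun_prop

lemma continuous_polar_left (x : ℝ) : Continuous fun r : ℝ => polar r x := by
  unfold polar; fun_prop

lemma hasDerivAt_polar (r x : ℝ) :
    HasDerivAt (fun r : ℝ => polar r x) (Complex.exp (Complex.I * x)) r := by
  simpa [polar] using (Complex.ofRealCLM.hasDerivAt (x := r)).mul_const (Complex.exp (Complex.I * x))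

lemma polar_eq_polar_iff {r s x y : ℝ} (hr : 0 < r) (hs : 0 < s) :
    polar r x = polar s y ↔ r = s ∧ (x : Real.Angle) = y := by
  constructor
  · intro h
    have h1 : r = s := by
      have := congrArg norm h
      rwa [norm_polar hr.le, norm_polar hs.le] at this
    subst h1
    refine ⟨rfl, ?_⟩
    have h2 : Complex.exp (Complex.I * x) = Complex.exp (Complex.I * y) :=
      mul_left_cancel₀ (Complex.ofReal_ne_zero.2 hr.ne') h
    rw [Complex.exp_eq_exp_iff_exists_int] at h2
    obtain ⟨n, hn⟩ := h2
    rw [Real.Angle.angle_eq_iff_two_pi_dvd_sub]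
    refine ⟨n, ?_⟩
    have : Complex.I * ((x : ℂ) - y - 2 * Real.pi * n) = 0 := by linear_combination hn
    rcases mul_eq_zero.1 this with h | h
    · exact absurd h Complex.I_ne_zero
    · exact_mod_cast (by linear_combination h : (x : ℂ) - y = 2 * Real.pi * n)
  · rintro ⟨rfl, h⟩
    apply Complex.ext
    · rw [polar_re, polar_re, ← Real.Angle.cos_coe, h, Real.Angle.cos_coe]
    · rw [polar_im, polar_im, ← Real.Angle.sin_coe, h, Real.Angle.sin_coe]

lemma exists_eq_polar (z : ℂ) : z = polar ‖z‖ (Complex.arg z) := by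
  rw [polar, mul_comm Complex.I, Complex.norm_mul_exp_arg_mul_I]

/-- Directions in an interval of length less than `2π` that agree modulo `2π` agree. -/
lemma eq_of_angle_eq {x y : ℝ} (h : (x : Real.Angle) = y) (hxy : |x - y| < 2 * Real.pi) :
    x = y := by
  rw [Real.Angle.angle_eq_iff_two_pi_dvd_sub] at h
  obtain ⟨k, hk⟩ := h
  have hpi := Real.pi_pos
  rw [hk, abs_mul, abs_of_pos (by positivity)] at hxy
  have h1 : |(k : ℝ)| < 1 := by
    by_contra! h
    nlinarith
  have : k = 0 := by
    have : |k| < 1 := by exact_mod_cast h1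
    exact Int.abs_lt_one_iff.1 this
  rw [this] at hk
  simp at hk
  linarith

lemma isOpen_sector (d α : ℝ) : IsOpen (sector d α) := by
  have : sector d α = Complex.exp '' (Complex.im ⁻¹' Ioo (d - α / 2) (d + α / 2)) := by
    ext s
    constructor
    · rintro ⟨r, x, hr, h1, h2, rfl⟩
      exact ⟨(Real.log r : ℝ) + (x : ℂ) * Complex.I, by simp [h1, h2], (polar_eq_exp hr x).symm⟩
    · rintro ⟨w, ⟨h1, h2⟩, rfl⟩
      exact ⟨Real.exp w.re, w.im, Real.exp_pos _, h1, h2, exp_eq_polar w⟩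
  rw [this]
  exact Complex.isOpenMap_exp _ (isOpen_Ioo.preimage Complex.continuous_im)

lemma isOpen_hatSector (d α ρ : ℝ) : IsOpen (hatSector d α ρ) :=
  Metric.isOpen_ball.union (isOpen_sector d α)

lemma polar_mem_sector {d α r x : ℝ} (hr : 0 < r) (h1 : d - α / 2 < x) (h2 : x < d + α / 2) :
    polar r x ∈ sector d α := ⟨r, x, hr, h1, h2, rfl⟩

/-- A closed sector that does not contain the point `p ≠ 0` has positive distance from it. -/
lemma exists_dist_polar {β₁ β₂ : ℝ} {p : ℂ} (hp : p ≠ 0)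
    (h : ∀ r x : ℝ, 0 < r → β₁ ≤ x → x ≤ β₂ → polar r x ≠ p) :
    ∃ c : ℝ, 0 < c ∧ ∀ r x : ℝ, 0 ≤ r → β₁ ≤ x → x ≤ β₂ → c ≤ ‖polar r x - p‖ := by
  have hp' : 0 < ‖p‖ := norm_pos_iff.2 hp
  rcases lt_or_ge β₂ β₁ with hβ | hβ
  · exact ⟨1, one_pos, fun r x _ h1 h2 => by linarith⟩
  -- Beyond radius `2‖p‖` the triangle inequality gives distance at least `‖p‖`. On the compact rest
  -- the minimum is positive; the vertex may be included because `p ≠ 0`.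
  have hK : IsCompact (Icc (0 : ℝ) (2 * ‖p‖) ×ˢ Icc β₁ β₂) := isCompact_Icc.prod isCompact_Icc
  obtain ⟨⟨r₀, x₀⟩, hmem, hmin⟩ := hK.exists_isMinOn
    ⟨(0, β₁), by simp [hβ]⟩
    (f := fun q : ℝ × ℝ => ‖polar q.1 q.2 - p‖) (by fun_prop)
  have hpos : 0 < ‖polar r₀ x₀ - p‖ := by
    rw [norm_pos_iff, sub_ne_zero]
    rcases hmem.1.1.eq_or_lt with h0 | h0
    · simp only at h0
      rw [← h0, polar_zero]; exact hp.symm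
    · exact h _ _ h0 hmem.2.1 hmem.2.2
  refine ⟨min ‖polar r₀ x₀ - p‖ ‖p‖, lt_min hpos hp', fun r x hr h1 h2 => ?_⟩
  rcases le_or_gt r (2 * ‖p‖) with h3 | h3
  · exact (min_le_left _ _).trans (hmin (a := (r, x)) ⟨⟨hr, h3⟩, h1, h2⟩)
  · refine (min_le_right _ _).trans ?_
    have := norm_sub_norm_le (polar r x) p
    rw [norm_polar hr] at this
    linarith

/-! ### Power series -/

/-- Uniqueness of power series expansions, in the form in which coefficients are compared below. -/
lemma coeff_eq_iteratedDeriv {f : ℂ → ℂ} {x : ℂ} {c : ℕ → ℂ}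
    (h : ∀ᶠ w in 𝓝 (0 : ℂ), HasSum (fun n : ℕ => w ^ n * c n) (f (x + w))) (n : ℕ) :
    c n = iteratedDeriv n f x / n.factorial := by
  have h1 : HasFPowerSeriesAt f (FormalMultilinearSeries.ofScalars ℂ c) x := by
    rw [hasFPowerSeriesAt_iff]
    simpa [FormalMultilinearSeries.coeff_ofScalars] using h
  have h2 := h1.analyticAt.hasFPowerSeriesAt
  have h3 := congrArg (fun q => FormalMultilinearSeries.coeff q n) (h1.eq_formalMultilinearSeries h2)
  simpa [FormalMultilinearSeries.coeff_ofScalars] using h3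

lemma hasSum_taylor {f : ℂ → ℂ} {x w : ℂ} {ρ : ℝ} (hf : DifferentiableOn ℂ f (Metric.ball x ρ))
    (hw : ‖w‖ < ρ) :
    HasSum (fun n : ℕ => w ^ n * (iteratedDeriv n f x / n.factorial)) (f (x + w)) := by
  have := Complex.hasSum_taylorSeries_on_ball hf (z := x + w) (by simpa using hw)
  convert! this using 2 with n
  simp only [add_sub_cancel_left, smul_eq_mul]
  ring

lemma analyticAt_of_hasSum {f : ℂ → ℂ} {x : ℂ} {c : ℕ → ℂ}
    (h : ∀ᶠ w in 𝓝 (0 : ℂ), HasSum (fun n : ℕ => w ^ n * c n) (f (x + w))) :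
    AnalyticAt ℂ f x := by
  have h1 : HasFPowerSeriesAt f (FormalMultilinearSeries.ofScalars ℂ c) x := by
    rw [hasFPowerSeriesAt_iff]
    simpa [FormalMultilinearSeries.coeff_ofScalars] using h
  exact h1.analyticAt

/-- A function holomorphic off `p` that is the sum of a series in negative powers of `z - p` far
from `p` is the sum of that series everywhere, and the coefficients are those of an entire
function. -/
lemma hasSum_principalPart {c : ℕ → ℂ} {f : ℂ → ℂ} {p : ℂ} (hf : DifferentiableOn ℂ f {p}ᶜ)
    (h : ∀ z : ℂ, 1 ≤ ‖z - p‖ → HasSum (fun n : ℕ => c n / (z - p) ^ (n + 1)) (f z)) :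
    (∀ M : ℝ, 0 ≤ M → Summable fun n : ℕ => ‖c n‖ * M ^ (n + 1)) ∧
      ∀ z : ℂ, z ≠ p → HasSum (fun n : ℕ => c n / (z - p) ^ (n + 1)) (f z) := by
  -- The coordinate `w = 1/(z - p)` moves infinity to `0`. The series has no constant term, so `g 0
  -- = 0`, and `cc` is `c` shifted by one index.
  set g : ℂ → ℂ := fun w => if w = 0 then 0 else f (p + w⁻¹) with hg
  set cc : ℕ → ℂ := fun n => Nat.casesOn n 0 c with hcc
  have hshift : ∀ w v : ℂ, HasSum (fun n : ℕ => w ^ n * cc n) v ↔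
      HasSum (fun n : ℕ => w ^ (n + 1) * c n) v := by
    intro w v
    rw [← hasSum_nat_add_iff' 1]
    simp [hcc]
  have h0 : ∀ᶠ w in 𝓝 (0 : ℂ), HasSum (fun n : ℕ => w ^ n * cc n) (g (0 + w)) := by
    filter_upwards [Metric.ball_mem_nhds (0 : ℂ) one_pos] with w hw
    rw [hshift, zero_add]
    rcases eq_or_ne w 0 with rfl | hw0
    · simp [hg, hasSum_zero]
    · have hw1 : ‖w‖ < 1 := by simpa using hw
      have := h (p + w⁻¹) (by
        rw [add_sub_cancel_left, norm_inv]
        exact (one_le_inv₀ (norm_pos_iff.2 hw0)).2 hw1.le)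
      simp only [hg, if_neg hw0]
      convert! this using 2 with n
      rw [add_sub_cancel_left, inv_pow, div_inv_eq_mul, mul_comm]
  have hgd : Differentiable ℂ g := by
    intro w
    rcases eq_or_ne w 0 with rfl | hw0
    · exact (analyticAt_of_hasSum h0).differentiableAt
    · have h1 : DifferentiableAt ℂ f (p + w⁻¹) :=
        hf.differentiableAt (isOpen_compl_singleton.mem_nhds (by simpa using hw0))
      have h2 : DifferentiableAt ℂ (fun w : ℂ => f (p + w⁻¹)) w :=
        h1.comp w ((differentiableAt_const p).add (differentiableAt_inv hw0))
      refine h2.congr_of_eventuallyEq ?_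
      filter_upwards [isOpen_ne.mem_nhds hw0] with v hv
      simp [hg, show v ≠ 0 from hv]
  -- The Taylor series of an entire function converges everywhere, and its coefficients are already
  -- known from the unit disc.
  have hall : ∀ w : ℂ, HasSum (fun n : ℕ => w ^ (n + 1) * c n) (g w) := by
    intro w
    rw [← hshift]
    have := hasSum_taylor (x := 0) (w := w) hgd.differentiableOn (lt_add_one ‖w‖)
    rw [zero_add] at this
    convert! this using 3 with n
    exact coeff_eq_iteratedDeriv h0 n
  constructor
  · intro M hM
    have := (hall (M : ℂ)).summable.norm
    refine this.congr fun n => ?_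
    rw [norm_mul, norm_pow, Complex.norm_real, Real.norm_of_nonneg hM, mul_comm]
  · intro z hz
    have hz' : z - p ≠ 0 := sub_ne_zero.2 hz
    have := hall (z - p)⁻¹
    simp only [hg, inv_eq_zero, if_neg hz', inv_inv, add_sub_cancel] at this
    convert! this using 2 with n
    rw [inv_pow, mul_comm, div_eq_mul_inv]

/-! ### Principal parts -/

/-- The principal part at `p` with the coefficients `b n` of `(s - p)⁻⁽ⁿ⁺¹⁾`. -/
def principalPart (b : ℕ → ℂ) (p s : ℂ) : ℂ := ∑' n : ℕ, b n / (s - p) ^ (n + 1)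

/-- The coefficients of a principal part that converges off its pole. -/
def RapidDecay (b : ℕ → ℂ) : Prop := ∀ M : ℝ, 0 ≤ M → Summable fun n : ℕ => ‖b n‖ * M ^ (n + 1)

lemma norm_div_pow_le {b p s : ℂ} {c : ℝ} (hc : 0 < c) (hs : c ≤ ‖s - p‖) (n : ℕ) :
    ‖b / (s - p) ^ (n + 1)‖ ≤ ‖b‖ * c⁻¹ ^ (n + 1) := by
  rw [norm_div, norm_pow, div_eq_mul_inv, ← inv_pow]
  gcongr

lemma RapidDecay.hasSum {b : ℕ → ℂ} (hb : RapidDecay b) {p s : ℂ} (hs : s ≠ p) :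
    HasSum (fun n : ℕ => b n / (s - p) ^ (n + 1)) (principalPart b p s) := by
  have hc : 0 < ‖s - p‖ := norm_pos_iff.2 (sub_ne_zero.2 hs)
  exact (Summable.of_norm_bounded (hb _ (inv_nonneg.2 hc.le))
    fun n => norm_div_pow_le hc le_rfl n).hasSum

lemma RapidDecay.tendstoUniformlyOn {b : ℕ → ℂ} (hb : RapidDecay b) {p : ℂ} {c : ℝ} (hc : 0 < c) :
    TendstoUniformlyOn (fun (N : ℕ) s => ∑ n ∈ Finset.range N, b n / (s - p) ^ (n + 1))
      (principalPart b p) atTop {s | c ≤ ‖s - p‖} :=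
  tendstoUniformlyOn_tsum_nat (hb _ (inv_nonneg.2 hc.le)) fun n _ hs => norm_div_pow_le hc hs n

lemma RapidDecay.tendstoLocallyUniformlyOn {b : ℕ → ℂ} (hb : RapidDecay b) (p : ℂ) :
    TendstoLocallyUniformlyOn (fun (N : ℕ) s => ∑ n ∈ Finset.range N, b n / (s - p) ^ (n + 1))
      (principalPart b p) atTop {p}ᶜ := by
  rw [tendstoLocallyUniformlyOn_iff_forall_isCompact isOpen_compl_singleton]
  intro K hK hKc
  rcases K.eq_empty_or_nonempty with rfl | hne
  · exact tendstoUniformlyOn_empty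
  obtain ⟨s₀, hs₀, hmin⟩ := hKc.exists_isMinOn hne (f := fun s => ‖s - p‖) (by fun_prop)
  exact (hb.tendstoUniformlyOn (norm_pos_iff.2 (sub_ne_zero.2 (hK hs₀)))).mono
    fun s hs => hmin hs

lemma RapidDecay.differentiableOn {b : ℕ → ℂ} (hb : RapidDecay b) (p : ℂ) :
    DifferentiableOn ℂ (principalPart b p) {p}ᶜ := by
  refine (hb.tendstoLocallyUniformlyOn p).differentiableOn (.of_forall fun N => ?_)
    isOpen_compl_singleton
  refine DifferentiableOn.fun_sum fun n _ => ?_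
  intro s hs
  have : (s - p) ^ (n + 1) ≠ 0 := pow_ne_zero _ (sub_ne_zero.2 hs)
  fun_prop (disch := assumption)

lemma RapidDecay.differentiableAt {b : ℕ → ℂ} (hb : RapidDecay b) {p s : ℂ} (hs : s ≠ p) :
    DifferentiableAt ℂ (principalPart b p) s :=
  (hb.differentiableOn p).differentiableAt (isOpen_compl_singleton.mem_nhds hs)

lemma RapidDecay.exists_bound {b : ℕ → ℂ} (hb : RapidDecay b) {c : ℝ} (hc : 0 < c) :
    ∃ B : ℝ, 0 < B ∧ ∀ p s : ℂ, c ≤ ‖s - p‖ → ‖principalPart b p s‖ ≤ B := by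
  have h := hb _ (inv_nonneg.2 hc.le)
  refine ⟨∑' n : ℕ, ‖b n‖ * c⁻¹ ^ (n + 1) + 1, ?_, fun p s hs => ?_⟩
  · have : 0 ≤ ∑' n : ℕ, ‖b n‖ * c⁻¹ ^ (n + 1) := tsum_nonneg fun n => by positivity
    linarith
  · exact (tsum_of_norm_bounded h.hasSum fun n => norm_div_pow_le hc hs n).trans (by linarith)

lemma principalPart_translate (b : ℕ → ℂ) (p z s : ℂ) :
    principalPart b p (z + s) = principalPart b (p - z) s := by
  simp only [principalPart, show z + s - p = s - (p - z) by ring]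

/-- A principal part that is bounded near its pole vanishes. -/
lemma RapidDecay.eq_zero_of_bounded {b : ℕ → ℂ} (hb : RapidDecay b) {p : ℂ} {c B : ℝ} (hc : 0 < c)
    (h : ∀ s : ℂ, s ≠ p → ‖s - p‖ < c → ‖principalPart b p s‖ ≤ B) : b = 0 := by
  set g : ℂ → ℂ := fun w => ∑' n : ℕ, w ^ (n + 1) * b n with hg
  set cc : ℕ → ℂ := fun n => Nat.casesOn n 0 b with hcc
  have hsum : ∀ w : ℂ, HasSum (fun n : ℕ => w ^ n * cc n) (g w) := by
    intro w
    rw [← hasSum_nat_add_iff' 1]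
    have : HasSum (fun n : ℕ => w ^ (n + 1) * b n) (g w) :=
      (Summable.of_norm_bounded (hb _ (norm_nonneg w)) fun n => by
        rw [norm_mul, norm_pow, mul_comm]).hasSum
    simpa [hcc] using this
  have hgp : ∀ w : ℂ, w ≠ 0 → g w = principalPart b p (p + w⁻¹) := by
    intro w hw
    simp only [hg, principalPart, add_sub_cancel_left, inv_pow, div_inv_eq_mul, mul_comm]
  have hgd : Differentiable ℂ g := by
    intro w
    rcases eq_or_ne w 0 with rfl | hw0
    · exact (analyticAt_of_hasSum (c := cc) (.of_forall fun w => by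
        rw [zero_add]; exact hsum w)).differentiableAt
    · have h1 : DifferentiableAt ℂ (principalPart b p) (p + w⁻¹) :=
        hb.differentiableAt (by simpa using hw0)
      have h2 : DifferentiableAt ℂ (fun w : ℂ => principalPart b p (p + w⁻¹)) w :=
        h1.comp w ((differentiableAt_const p).add (differentiableAt_inv hw0))
      refine h2.congr_of_eventuallyEq ?_
      filter_upwards [isOpen_ne.mem_nhds hw0] with v hv
      exact hgp v hv
  -- Large `w` corresponds to points near the pole, where the hypothesis bounds the function; the
  -- other `w ≠ 0` correspond to points at distance at least `c`, where a principal part is always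
  -- bounded. Liouville then applies to `g`.
  have hbd : Bornology.IsBounded (range g) := by
    obtain ⟨B', -, hB'⟩ := hb.exists_bound hc
    rw [isBounded_iff_forall_norm_le]
    refine ⟨max (max B B') ‖g 0‖, ?_⟩
    rintro _ ⟨w, rfl⟩
    rcases eq_or_ne w 0 with rfl | hw
    · exact le_max_right _ _
    refine le_trans ?_ (le_max_left _ _)
    rw [hgp w hw]
    rcases lt_or_ge ‖w⁻¹‖ c with h1 | h1
    · exact (h _ (by simpa using hw) (by simpa using h1)).trans (le_max_left _ _)
    · exact (hB' _ _ (by simpa using h1)).trans (le_max_right _ _)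
  have hconst : ∀ w, g w = g 0 := fun w => hgd.apply_eq_apply_of_bounded hbd w 0
  have hg0 : g 0 = 0 := by simp [hg]
  have hz : ∀ n, cc n = 0 := by
    intro n
    rw [coeff_eq_iteratedDeriv (c := cc) (f := g) (x := 0) (.of_forall fun w => by
        rw [zero_add]; exact hsum w) n, show g = fun _ => 0 from funext fun w => by
        rw [hconst, hg0]]
    simp
  ext n
  exact hz (n + 1)

/-! ### Integrals along half-lines -/

lemma norm_exp_I_mul (x : ℝ) : ‖Complex.exp (Complex.I * x)‖ = 1 := by
  rw [mul_comm, Complex.norm_exp_ofReal_mul_I]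

lemma integrable_const_div (C : ℝ) : Integrable fun r : ℝ => C / (1 + r ^ 2) := by
  simpa [div_eq_mul_inv] using integrable_inv_one_add_sq.const_mul C

lemma integrableOn_of_bound {f : ℝ → ℂ} {C : ℝ} (hf : ContinuousOn f (Ioi 0))
    (hb : ∀ r : ℝ, 0 < r → ‖f r‖ ≤ C / (1 + r ^ 2)) : IntegrableOn f (Ioi 0) :=
  (integrable_const_div C).integrableOn.mono' (hf.aestronglyMeasurable measurableSet_Ioi)
    ((ae_restrict_iff' measurableSet_Ioi).2 (.of_forall hb))

lemma continuousOn_comp_polar {f : ℂ → ℂ} {x : ℝ}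
    (hd : ∀ r : ℝ, 0 < r → DifferentiableAt ℂ f (polar r x)) :
    ContinuousOn (fun r => f (polar r x)) (Ioi 0) := fun r hr =>
  (ContinuousAt.comp (f := fun r => polar r x) (hd r hr).continuousAt
    (continuous_polar_left x).continuousAt).continuousWithinAt

lemma integrableOn_comp_polar {f : ℂ → ℂ} {x C : ℝ}
    (hd : ∀ r : ℝ, 0 < r → DifferentiableAt ℂ f (polar r x))
    (hb : ∀ r : ℝ, 0 < r → ‖f (polar r x)‖ ≤ C / (1 + r ^ 2)) :
    IntegrableOn (fun r => f (polar r x)) (Ioi 0) :=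
  integrableOn_of_bound (continuousOn_comp_polar hd) hb

lemma rayIntegral_add {f g : ℂ → ℂ} {x : ℝ} (hf : IntegrableOn (fun r => f (polar r x)) (Ioi 0))
    (hg : IntegrableOn (fun r => g (polar r x)) (Ioi 0)) :
    rayIntegral (fun s => f s + g s) x = rayIntegral f x + rayIntegral g x := by
  simp only [rayIntegral, add_mul]
  exact integral_add (hf.mul_const _) (hg.mul_const _)

lemma rayIntegral_const_mul (c : ℂ) (f : ℂ → ℂ) (x : ℝ) :
    rayIntegral (fun s => c * f s) x = c * rayIntegral f x := by
  simp only [rayIntegral, mul_assoc]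
  exact integral_const_mul _ _

lemma rayIntegral_congr {f g : ℂ → ℂ} {x : ℝ} (h : ∀ r : ℝ, 0 < r → f (polar r x) = g (polar r x)) :
    rayIntegral f x = rayIntegral g x :=
  setIntegral_congr_fun measurableSet_Ioi fun r hr => by simp only [h r hr]

lemma image_exp_univ : Real.exp '' univ = Ioi 0 := by rw [image_univ, Real.range_exp]

lemma rayIntegral_eq_integral_exp (f : ℂ → ℂ) (x : ℝ) :
    rayIntegral f x =
      ∫ u : ℝ, f (Complex.exp (u + x * Complex.I)) * Complex.exp (u + x * Complex.I) := by
  rw [rayIntegral, ← image_exp_univ, integral_image_eq_integral_abs_deriv_smul MeasurableSet.univ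
    (fun u _ => (Real.hasDerivAt_exp u).hasDerivWithinAt) Real.exp_injective.injOn,
    Measure.restrict_univ]
  refine integral_congr_ae (.of_forall fun u => ?_)
  simp only [exp_eq_polar, abs_of_pos (Real.exp_pos u)]
  simp [polar]
  ring

lemma integrable_exp_of_integrableOn {f : ℂ → ℂ} {x : ℝ}
    (h : IntegrableOn (fun r => f (polar r x)) (Ioi 0)) :
    Integrable fun u : ℝ =>
      f (Complex.exp (u + x * Complex.I)) * Complex.exp (u + x * Complex.I) := by
  have h1 : IntegrableOn (fun r => f (polar r x) * Complex.exp (Complex.I * x)) (Ioi 0) :=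
    h.mul_const _
  rw [← image_exp_univ, integrableOn_image_iff_integrableOn_abs_deriv_smul MeasurableSet.univ
    (fun u _ => (Real.hasDerivAt_exp u).hasDerivWithinAt) Real.exp_injective.injOn,
    integrableOn_univ] at h1
  refine h1.congr (.of_forall fun u => ?_)
  simp only [exp_eq_polar, abs_of_pos (Real.exp_pos u)]
  simp [polar]
  ring

/-- The direction of integration may be turned in a sector of holomorphy and decay. -/
lemma rayIntegral_eq_of_differentiableAt {f : ℂ → ℂ} {β₁ β₂ C : ℝ} (hβ : β₁ ≤ β₂)
    (hd : ∀ r x : ℝ, 0 < r → β₁ ≤ x → x ≤ β₂ → DifferentiableAt ℂ f (polar r x))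
    (hb : ∀ r x : ℝ, 0 < r → β₁ ≤ x → x ≤ β₂ → ‖f (polar r x)‖ ≤ C / (1 + r ^ 2)) :
    rayIntegral f β₁ = rayIntegral f β₂ := by
  -- With `s = exp w` the sector becomes a horizontal strip, and Cauchy's theorem is applied to
  -- rectangles `[-T, T] × [β₁, β₂]`. The factor `exp w` gives decay at the vertex and `1/(1 + r²)`
  -- gives decay at infinity, so both vertical sides are `O(exp(-T))`.
  set F : ℂ → ℂ := fun w => f (Complex.exp w) * Complex.exp w with hF
  have hC : 0 ≤ C := by
    have := (norm_nonneg _).trans (hb 1 β₁ one_pos le_rfl hβ)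
    norm_num at this
    linarith
  have hlim : ∀ x, β₁ ≤ x → x ≤ β₂ → Tendsto (fun T : ℝ => ∫ u in (-T)..T, F (u + x * Complex.I))
      atTop (𝓝 (rayIntegral f x)) := by
    intro x h1 h2
    rw [rayIntegral_eq_integral_exp]
    exact intervalIntegral_tendsto_integral (integrable_exp_of_integrableOn
      (integrableOn_comp_polar (fun r hr => hd r x hr h1 h2) fun r hr => hb r x hr h1 h2))
      tendsto_neg_atTop_atBot tendsto_id
  have hbound : ∀ T y : ℝ, β₁ ≤ y → y ≤ β₂ → ‖F (T + y * Complex.I)‖ ≤ C * Real.exp (-|T|) := by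
    intro T y h1 h2
    simp only [hF, exp_eq_polar, norm_mul]
    simp only [Complex.add_re, Complex.ofReal_re, Complex.mul_re, Complex.I_re, mul_zero,
      Complex.ofReal_im, Complex.I_im, mul_one, add_zero, Complex.add_im, Complex.mul_im,
      zero_add, sub_self]
    rw [norm_polar (Real.exp_pos T).le]
    have hT := Real.exp_pos T
    refine (mul_le_mul_of_nonneg_right (hb _ y hT h1 h2) hT.le).trans ?_
    rw [div_mul_eq_mul_div, div_le_iff₀ (by positivity), mul_assoc]
    gcongr
    rcases abs_cases T with ⟨h, -⟩ | ⟨h, -⟩ <;> rw [h]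
    · rw [Real.exp_neg]
      field_simp
      nlinarith
    · rw [neg_neg]; nlinarith [sq_nonneg (Real.exp T)]
  have hvert : ∀ T : ℝ, ‖∫ y in β₁..β₂, F (T + y * Complex.I)‖ ≤
      C * Real.exp (-|T|) * |β₂ - β₁| := by
    intro T
    refine intervalIntegral.norm_integral_le_of_norm_le_const fun y hy => ?_
    rw [uIoc_of_le hβ] at hy
    exact hbound T y hy.1.le hy.2
  have hexp : Tendsto (fun T : ℝ => C * Real.exp (-|T|) * |β₂ - β₁|) atTop (𝓝 0) := by
    have h1 : Tendsto (fun T : ℝ => Real.exp (-|T|)) atTop (𝓝 0) :=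
      Real.tendsto_exp_neg_atTop_nhds_zero.comp tendsto_abs_atTop_atTop
    simpa using (h1.const_mul C).mul_const |β₂ - β₁|
  have hv1 : Tendsto (fun T : ℝ => ∫ y in β₁..β₂, F (T + y * Complex.I)) atTop (𝓝 0) :=
    squeeze_zero_norm hvert hexp
  have hv2 : Tendsto (fun T : ℝ => ∫ y in β₁..β₂, F ((-T : ℝ) + y * Complex.I)) atTop (𝓝 0) :=
    squeeze_zero_norm (fun T => by simpa using hvert (-T)) hexp
  have hrect : ∀ T : ℝ, 0 ≤ T → (((∫ u in (-T)..T, F (u + β₁ * Complex.I)) -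
      ∫ u in (-T)..T, F (u + β₂ * Complex.I)) +
      Complex.I • ∫ y in β₁..β₂, F (T + y * Complex.I)) -
      Complex.I • ∫ y in β₁..β₂, F ((-T : ℝ) + y * Complex.I) = 0 := by
    intro T hT
    have := Complex.integral_boundary_rect_eq_zero_of_differentiableOn F
      ((-T : ℝ) + β₁ * Complex.I) (T + β₂ * Complex.I) ?_
    · simpa using this
    intro w hw
    rw [Complex.mem_reProdIm] at hw
    have him : w.im ∈ uIcc β₁ β₂ := by simpa using hw.2
    rw [uIcc_of_le hβ] at him
    have h1 : DifferentiableAt ℂ f (Complex.exp w) := by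
      rw [exp_eq_polar]; exact hd _ _ (Real.exp_pos _) him.1 him.2
    exact ((h1.comp w Complex.differentiableAt_exp).mul
      Complex.differentiableAt_exp).differentiableWithinAt
  have hl := (((hlim β₁ le_rfl hβ).sub (hlim β₂ hβ le_rfl)).add (hv1.const_smul Complex.I)).sub
    (hv2.const_smul Complex.I)
  have h0 := tendsto_nhds_unique (hl.congr' (by
    filter_upwards [eventually_ge_atTop 0] with T hT using hrect T hT)) tendsto_const_nhds
  simpa [sub_eq_zero] using h0

/-- A function that is continuous on a closed sector and decays at infinity is bounded by a
multiple of `1 / (1 + r²)`. -/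
lemma exists_bound_of_continuousAt {f : ℂ → ℂ} {β₁ β₂ M C : ℝ}
    (hf : ∀ r x : ℝ, 0 ≤ r → β₁ ≤ x → x ≤ β₂ → ContinuousAt f (polar r x))
    (hb : ∀ r x : ℝ, M ≤ r → β₁ ≤ x → x ≤ β₂ → ‖f (polar r x)‖ ≤ C / (1 + r ^ 2)) :
    ∃ C' : ℝ, 0 ≤ C' ∧
      ∀ r x : ℝ, 0 ≤ r → β₁ ≤ x → x ≤ β₂ → ‖f (polar r x)‖ ≤ C' / (1 + r ^ 2) := by
  have hK : IsCompact (Icc (0 : ℝ) M ×ˢ Icc β₁ β₂) := isCompact_Icc.prod isCompact_Icc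
  have hcont : ContinuousOn (fun q : ℝ × ℝ => f (polar q.1 q.2)) (Icc (0 : ℝ) M ×ˢ Icc β₁ β₂) :=
    fun q hq => (ContinuousAt.comp (f := fun q : ℝ × ℝ => polar q.1 q.2)
      (hf q.1 q.2 hq.1.1 hq.2.1 hq.2.2) continuous_polar.continuousAt).continuousWithinAt
  obtain ⟨B, hB⟩ := hK.exists_bound_of_continuousOn hcont
  refine ⟨max (|B| * (1 + M ^ 2)) |C|, by positivity, fun r x hr h1 h2 => ?_⟩
  rcases le_or_gt M r with h3 | h3
  · refine (hb r x h3 h1 h2).trans ?_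
    gcongr
    exact (le_abs_self C).trans (le_max_right _ _)
  · rw [le_div_iff₀ (by positivity)]
    refine le_trans ?_ (le_max_left _ _)
    gcongr
    exact (hB (r, x) ⟨⟨hr, h3.le⟩, h1, h2⟩).trans (le_abs_self B)

/-! ### The jump of a Cauchy type integral -/

lemma polar_ne_polar {r s x y : ℝ} (hr : 0 < r) (hs : 0 < s) (hxy : x ≠ y)
    (h : |x - y| < 2 * Real.pi) : polar r x ≠ polar s y := fun he =>
  hxy (eq_of_angle_eq ((polar_eq_polar_iff hr hs).1 he).2 h)

lemma polar_ne_neg_polar {r s x y : ℝ} (hr : 0 ≤ r) (hs : 0 < s) (h : |x - y| < Real.pi) :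
    polar r x ≠ -polar s y := by
  rcases hr.eq_or_lt with rfl | hr
  · rw [polar_zero]; exact (neg_ne_zero.2 (polar_ne_zero hs y)).symm
  rw [← polar_add_pi]
  rw [abs_lt] at h
  refine polar_ne_polar hr hs (by linarith) ?_
  rw [abs_lt]
  constructor <;> linarith

/-- The sign of this imaginary part tells on which side of the branch cut of `log` the quotient
lies. -/
lemma im_sub_div_add (r s x y : ℝ) : ((polar s y - polar r x) / (polar s y + polar r x)).im =
    -(2 * r * s * Real.sin (x - y)) / Complex.normSq (polar s y + polar r x) := by
  rw [Complex.div_im]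
  simp only [Complex.sub_re, Complex.sub_im, Complex.add_re, Complex.add_im, polar_re, polar_im,
    Real.sin_sub]
  ring

lemma tendsto_sub_div_add (p : ℂ) (x : ℝ) :
    Tendsto (fun r : ℝ => (p - polar r x) / (p + polar r x)) atTop (𝓝 (-1)) := by
  have h1 : Tendsto (fun r : ℝ => ‖p + polar r x‖) atTop atTop := by
    refine tendsto_atTop_mono' atTop ?_ (tendsto_atTop_add_const_right atTop (-‖p‖) tendsto_id)
    filter_upwards [eventually_ge_atTop 0] with r hr
    have := norm_sub_norm_le (polar r x) (-p)
    rw [norm_polar hr, norm_neg, sub_neg_eq_add, add_comm (polar r x)] at this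
    simpa [sub_eq_add_neg] using this
  have h2 : Tendsto (fun r : ℝ => 2 * p * (p + polar r x)⁻¹) atTop (𝓝 0) := by
    have := (tendsto_inv₀_cobounded.comp (tendsto_norm_atTop_iff_cobounded.1 h1)).const_mul (2 * p)
    simpa using this
  have h3 := h2.sub_const 1
  rw [zero_sub] at h3
  refine h3.congr' ?_
  filter_upwards [h1.eventually_gt_atTop 0] with r hr
  have : p + polar r x ≠ 0 := norm_pos_iff.1 hr
  field_simp
  ring

/-- The integrand is the derivative of `log ((p - w)/(p + w))` with `p = polar s y`. On a ray not
parallel to `p` the quotient is real only at the vertex, where it equals `1`, so the principal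
branch serves on the whole ray and the integral is the limit at infinity. -/
lemma rayIntegral_log_kernel {s x y : ℝ} {v : ℂ} (hs : 0 < s) (hsin : Real.sin (x - y) ≠ 0)
    (hint : IntegrableOn (fun r => 2 * polar s y /
      ((polar r x - polar s y) * (polar r x + polar s y))) (Ioi 0))
    (hv : Tendsto (fun r => Complex.log ((polar s y - polar r x) / (polar s y + polar r x)))
      atTop (𝓝 v)) :
    rayIntegral (fun w => 2 * polar s y / ((w - polar s y) * (w + polar s y))) x = v := by
  have hp : polar s y ≠ 0 := polar_ne_zero hs y
  have hne : ∀ r : ℝ, 0 ≤ r → polar s y + polar r x ≠ 0 := by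
    intro r hr h
    rcases hr.eq_or_lt with rfl | hr
    · rw [polar_zero, add_zero] at h; exact hp h
    -- After multiplication by the conjugate of `p` the imaginary part of the supposed relation
    -- reads `r s sin(x - y) = 0`.
    · have h1 : polar r x * (starRingEnd ℂ) (polar s y) =
          -(polar s y * (starRingEnd ℂ) (polar s y)) := by
        linear_combination (starRingEnd ℂ) (polar s y) * h
      have h2 := congrArg Complex.im h1
      rw [Complex.mul_conj] at h2
      simp only [Complex.mul_im, Complex.conj_re, Complex.conj_im, polar_re, polar_im,
        Complex.neg_im, Complex.ofReal_im, neg_zero] at h2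
      apply mul_ne_zero (mul_ne_zero hr.ne' hs.ne') hsin
      rw [Real.sin_sub]
      linear_combination h2
  have hslit : ∀ r : ℝ, 0 ≤ r →
      (polar s y - polar r x) / (polar s y + polar r x) ∈ Complex.slitPlane := by
    intro r hr
    have h0 := hne r hr
    rcases hr.eq_or_lt with rfl | hr
    · rw [polar_zero, sub_zero, add_zero, div_self hp]; exact Complex.one_mem_slitPlane
    · rw [Complex.mem_slitPlane_iff]
      right
      rw [im_sub_div_add]
      exact div_ne_zero (neg_ne_zero.2 (mul_ne_zero (by positivity) hsin))
        (Complex.normSq_pos.2 h0).ne'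
  have hderiv : ∀ r ∈ Ici (0 : ℝ), HasDerivAt
      (fun r => Complex.log ((polar s y - polar r x) / (polar s y + polar r x)))
      (2 * polar s y / ((polar r x - polar s y) * (polar r x + polar s y)) *
        Complex.exp (Complex.I * x)) r := by
    intro r hr
    have h0 := hne r hr
    have h1 : polar s y - polar r x ≠ 0 := by
      have := Complex.slitPlane_ne_zero (hslit r hr)
      exact (div_ne_zero_iff.1 this).1
    have hd := (((hasDerivAt_polar r x).const_sub (polar s y)).div
      ((hasDerivAt_polar r x).const_add (polar s y)) h0).clog_real (hslit r hr)
    convert! hd using 1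
    have h2 : polar r x - polar s y ≠ 0 := by rw [← neg_sub]; exact neg_ne_zero.2 h1
    have h3 : polar r x + polar s y ≠ 0 := by rwa [add_comm]
    simp only [Pi.div_apply]
    field_simp
    ring
  have := integral_Ioi_of_hasDerivAt_of_tendsto' hderiv (hint.mul_const _) hv
  rw [rayIntegral, this, polar_zero, sub_zero, add_zero, div_self hp, Complex.log_one, sub_zero]

/-- The quotient tends to `-1` from the lower half-plane here, and from the upper one when the sine
is negative. The difference `-2πi` of the two limits is the residue contribution. -/
lemma tendsto_log_of_sin_pos {s x y : ℝ} (hs : 0 < s) (hsin : 0 < Real.sin (x - y)) :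
    Tendsto (fun r => Complex.log ((polar s y - polar r x) / (polar s y + polar r x))) atTop
      (𝓝 (-(Real.pi * Complex.I))) := by
  have h1 := Complex.tendsto_log_nhdsWithin_im_neg_of_re_neg_of_im_zero (z := -1)
    (by simp) (by simp)
  simp only [norm_neg, norm_one, Real.log_one, Complex.ofReal_zero, zero_sub] at h1
  refine h1.comp (tendsto_nhdsWithin_iff.2 ⟨tendsto_sub_div_add _ _, ?_⟩)
  have h2 := (tendsto_sub_div_add (polar s y) x).eventually_ne
    (show (-1 : ℂ) ≠ 0 by simp)
  filter_upwards [eventually_gt_atTop 0, h2] with r hr hne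
  rw [im_sub_div_add]
  have := (div_ne_zero_iff.1 hne).2
  exact div_neg_of_neg_of_pos (neg_lt_zero.2 (by positivity)) (Complex.normSq_pos.2 this)

lemma tendsto_log_of_sin_neg {s x y : ℝ} (hs : 0 < s) (hsin : Real.sin (x - y) < 0) :
    Tendsto (fun r => Complex.log ((polar s y - polar r x) / (polar s y + polar r x))) atTop
      (𝓝 (Real.pi * Complex.I)) := by
  have h1 := Complex.tendsto_log_nhdsWithin_im_nonneg_of_re_neg_of_im_zero (z := -1)
    (by simp) (by simp)
  simp only [norm_neg, norm_one, Real.log_one, Complex.ofReal_zero, zero_add] at h1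
  refine h1.comp (tendsto_nhdsWithin_iff.2 ⟨tendsto_sub_div_add _ _, ?_⟩)
  filter_upwards [eventually_gt_atTop 0] with r hr
  rw [im_sub_div_add]
  refine div_nonneg (neg_nonneg.2 ?_) (Complex.normSq_nonneg _)
  exact mul_nonpos_of_nonneg_of_nonpos (by positivity) hsin.le

lemma norm_half_le {p w : ℂ} {r : ℝ} (hw : ‖w‖ = r) (hr : 2 * ‖p‖ ≤ r) : r / 2 ≤ ‖w - p‖ := by
  have := norm_sub_norm_le w p
  linarith

/-- Subtract from `ψ` the multiple of `2p/(w + p)` that takes the same value at `p`. The difference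
divided by `w - p` is holomorphic in the sector and decays, so its ray integral is independent of
the direction. What remains is `ψ(p)` times the logarithmic kernel, whose integrals along the two
rays differ by `-2πi`. The condition `dp - dm < π` keeps the auxiliary pole `-p` out of the sector,
and this pole makes the remaining kernel decay like `r⁻²`. -/
lemma jump_cauchy {dm dp s y C : ℝ} {ψ : ℂ → ℂ} (hs : 0 < s) (h1 : dm < y) (h2 : y < dp)
    (hlt : dp - dm < Real.pi)
    (hd : ∀ r x : ℝ, 0 ≤ r → dm ≤ x → x ≤ dp → DifferentiableAt ℂ ψ (polar r x))
    (hb : ∀ r x : ℝ, 0 < r → dm ≤ x → x ≤ dp → ‖ψ (polar r x)‖ ≤ C / (1 + r ^ 2)) :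
    rayIntegral (fun w => (w - polar s y)⁻¹ * ψ w) dp -
      rayIntegral (fun w => (w - polar s y)⁻¹ * ψ w) dm =
      -(2 * Real.pi * Complex.I) * ψ (polar s y) := by
  set p : ℂ := polar s y with hp
  have hp0 : p ≠ 0 := polar_ne_zero hs y
  have hC : 0 ≤ C := by
    have := (norm_nonneg _).trans (hb 1 y one_pos h1.le h2.le)
    norm_num at this
    linarith
  have hneg : ∀ r x : ℝ, 0 ≤ r → dm ≤ x → x ≤ dp → polar r x + p ≠ 0 := by
    intro r x hr hx1 hx2 h
    refine polar_ne_neg_polar hr hs ?_ (eq_neg_of_add_eq_zero_left h)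
    rw [abs_lt]; constructor <;> linarith
  set χ : ℂ → ℂ := fun w => ψ w - ψ p * (2 * p / (w + p)) with hχ
  have hχp : χ p = 0 := by
    simp only [hχ]
    rw [← two_mul, div_self (by simpa using hp0), mul_one, sub_self]
  have hχd : ∀ r x : ℝ, 0 ≤ r → dm ≤ x → x ≤ dp → DifferentiableAt ℂ χ (polar r x) := by
    intro r x hr hx1 hx2
    have := hneg r x hr hx1 hx2
    refine (hd r x hr hx1 hx2).sub ?_
    fun_prop (disch := assumption)
  set f : ℂ → ℂ := dslope χ p with hf
  have hfd : ∀ r x : ℝ, 0 ≤ r → dm ≤ x → x ≤ dp → DifferentiableAt ℂ f (polar r x) := by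
    intro r x hr hx1 hx2
    rcases eq_or_ne (polar r x) p with h | h
    · rw [h]
      have hopen : sector ((dm + dp) / 2) (dp - dm) ∈ 𝓝 p :=
        (isOpen_sector _ _).mem_nhds (polar_mem_sector hs (by linarith) (by linarith))
      refine DifferentiableOn.differentiableAt (s := sector ((dm + dp) / 2) (dp - dm)) ?_ hopen
      rw [hf, Complex.differentiableOn_dslope hopen]
      rintro _ ⟨r', x', hr', hx1', hx2', rfl⟩
      exact (hχd r' x' hr'.le (by linarith) (by linarith)).differentiableWithinAt
    · exact (differentiableAt_dslope_of_ne h).2 (hχd r x hr hx1 hx2)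
  have hfeq : ∀ w : ℂ, w ≠ p → f w = (w - p)⁻¹ * χ w := by
    intro w hw
    rw [hf, dslope_of_ne _ hw, slope_def_field, hχp, sub_zero, div_eq_mul_inv, mul_comm]
  -- Beyond this radius both `‖w - p‖` and `‖w + p‖` are at least `r/2`, and `r ≥ 1`.
  have hbig : ∀ r x : ℝ, 2 * ‖p‖ + 1 ≤ r → r / 2 ≤ ‖polar r x - p‖ ∧ r / 2 ≤ ‖polar r x + p‖ := by
    intro r x hr
    have hr0 : 0 ≤ r := by linarith [norm_nonneg p]
    refine ⟨norm_half_le (norm_polar hr0 x) (by linarith), ?_⟩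
    have := norm_half_le (p := -p) (norm_polar hr0 x) (by rw [norm_neg]; linarith)
    rwa [sub_neg_eq_add] at this
  have hkb : ∀ r x : ℝ, 2 * ‖p‖ + 1 ≤ r →
      ‖2 * p / ((polar r x - p) * (polar r x + p))‖ ≤ 16 * ‖p‖ / (1 + r ^ 2) := by
    intro r x hr
    obtain ⟨ha, hb⟩ := hbig r x hr
    have hr1 : 1 ≤ r := by linarith [norm_nonneg p]
    rw [norm_div, norm_mul, norm_mul, Complex.norm_ofNat]
    calc 2 * ‖p‖ / (‖polar r x - p‖ * ‖polar r x + p‖) ≤ 2 * ‖p‖ / (r / 2 * (r / 2)) := by gcongr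
      _ = 16 * ‖p‖ / (2 * r ^ 2) := by field_simp; ring
      _ ≤ _ := by gcongr; nlinarith
  obtain ⟨C', -, hC'⟩ := exists_bound_of_continuousAt (f := f) (β₁ := dm) (β₂ := dp)
    (M := 2 * ‖p‖ + 1) (C := 2 * C + ‖ψ p‖ * (16 * ‖p‖))
    (fun r x hr hx1 hx2 => (hfd r x hr hx1 hx2).continuousAt) (by
      intro r x hr hx1 hx2
      have hr1 : 1 ≤ r := by linarith [norm_nonneg p]
      obtain ⟨ha, -⟩ := hbig r x hr
      have hne : polar r x ≠ p := sub_ne_zero.1 (norm_pos_iff.1 (by linarith))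
      have hne' := hneg r x (by linarith) hx1 hx2
      have e : f (polar r x) = (polar r x - p)⁻¹ * ψ (polar r x) -
          ψ p * (2 * p / ((polar r x - p) * (polar r x + p))) := by
        have := sub_ne_zero.2 hne
        rw [hfeq _ hne]
        simp only [hχ]
        field_simp
      have e1 : ‖(polar r x - p)⁻¹ * ψ (polar r x)‖ ≤ 2 * (C / (1 + r ^ 2)) := by
        rw [norm_mul, norm_inv]
        gcongr
        · exact inv_le_of_inv_le₀ (by norm_num) (by linarith)
        · exact hb r x (by linarith) hx1 hx2
      have e2 : ‖ψ p * (2 * p / ((polar r x - p) * (polar r x + p)))‖ ≤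
          ‖ψ p‖ * (16 * ‖p‖ / (1 + r ^ 2)) := by
        rw [norm_mul]
        gcongr
        exact hkb r x hr
      rw [e]
      refine (norm_sub_le _ _).trans ((add_le_add e1 e2).trans (le_of_eq ?_))
      ring)
  have hrot := rayIntegral_eq_of_differentiableAt (f := f) (h1.trans h2).le
    (fun r x hr hx1 hx2 => hfd r x hr.le hx1 hx2) (fun r x hr hx1 hx2 => hC' r x hr.le hx1 hx2)
  have hsplit : ∀ x : ℝ, dm ≤ x → x ≤ dp → x ≠ y →
      IntegrableOn (fun r => 2 * p / ((polar r x - p) * (polar r x + p))) (Ioi 0) ∧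
      rayIntegral (fun w => (w - p)⁻¹ * ψ w) x = rayIntegral f x +
        ψ p * rayIntegral (fun w => 2 * p / ((w - p) * (w + p))) x := by
    intro x hx1 hx2 hxy
    have hne : ∀ r : ℝ, 0 ≤ r → polar r x - p ≠ 0 := by
      intro r hr
      rcases hr.eq_or_lt with rfl | hr
      · rw [polar_zero, zero_sub]; exact neg_ne_zero.2 hp0
      refine sub_ne_zero.2 (polar_ne_polar hr hs hxy ?_)
      rw [abs_lt]; constructor <;> linarith [Real.pi_pos]
    have hkd : ∀ r : ℝ, 0 ≤ r → DifferentiableAt ℂ (fun w => 2 * p / ((w - p) * (w + p)))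
        (polar r x) := by
      intro r hr
      have := mul_ne_zero (hne r hr) (hneg r x hr hx1 hx2)
      fun_prop (disch := assumption)
    obtain ⟨C'', -, hC''⟩ := exists_bound_of_continuousAt (β₁ := x) (β₂ := x)
      (f := fun w => 2 * p / ((w - p) * (w + p))) (M := 2 * ‖p‖ + 1) (C := 16 * ‖p‖)
      (fun r x' hr hx1' hx2' => by
        rw [le_antisymm hx2' hx1']; exact (hkd r hr).continuousAt)
      (fun r x' hr _ _ => hkb r x' hr)
    have hki : IntegrableOn (fun r => 2 * p / ((polar r x - p) * (polar r x + p))) (Ioi 0) :=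
      integrableOn_comp_polar (f := fun w => 2 * p / ((w - p) * (w + p)))
        (fun r hr => hkd r hr.le) (fun r hr => hC'' r x hr.le le_rfl le_rfl)
    have hfi : IntegrableOn (fun r => f (polar r x)) (Ioi 0) :=
      integrableOn_comp_polar (fun r hr => hfd r x hr.le hx1 hx2)
        (fun r hr => hC' r x hr.le hx1 hx2)
    refine ⟨hki, ?_⟩
    rw [← rayIntegral_const_mul, ← rayIntegral_add
      (g := fun w => ψ p * (2 * p / ((w - p) * (w + p)))) hfi (hki.const_mul (ψ p))]
    refine rayIntegral_congr fun r hr => ?_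
    have ha := hne r hr.le
    have hb := hneg r x hr.le hx1 hx2
    rw [hfeq _ (sub_ne_zero.1 ha)]
    simp only [hχ]
    field_simp
    ring
  obtain ⟨hi1, he1⟩ := hsplit dp (h1.trans h2).le le_rfl h2.ne'
  obtain ⟨hi2, he2⟩ := hsplit dm le_rfl (h1.trans h2).le h1.ne
  have hsp : 0 < Real.sin (dp - y) := Real.sin_pos_of_pos_of_lt_pi (by linarith) (by linarith)
  have hsm : Real.sin (dm - y) < 0 := by
    have := Real.sin_pos_of_pos_of_lt_pi (x := y - dm) (by linarith) (by linarith)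
    rw [← neg_sub, Real.sin_neg]; linarith
  rw [he1, he2, hrot, rayIntegral_log_kernel hs hsp.ne' hi1 (tendsto_log_of_sin_pos hs hsp),
    rayIntegral_log_kernel hs hsm.ne hi2 (tendsto_log_of_sin_neg hs hsm)]
  ring

lemma integrableOn_mul_of_bound {g ψ : ℂ → ℂ} {x B : ℝ}
    (hg : ∀ r : ℝ, 0 < r → DifferentiableAt ℂ g (polar r x))
    (hB : ∀ r : ℝ, 0 < r → ‖g (polar r x)‖ ≤ B)
    (hψ : IntegrableOn (fun r => ψ (polar r x)) (Ioi 0)) :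
    IntegrableOn (fun r => g (polar r x) * ψ (polar r x)) (Ioi 0) :=
  Integrable.bdd_mul hψ ((continuousOn_comp_polar hg).aestronglyMeasurable measurableSet_Ioi)
    ((ae_restrict_iff' measurableSet_Ioi).2 (.of_forall hB))

/-- Termwise integration: on a ray at distance `c` from the pole, the `L¹` norms of the terms are at
most `‖b n‖ c⁻⁽ⁿ⁺¹⁾` times the norm of `ψ`. -/
lemma hasSum_rayIntegral {b : ℕ → ℂ} {ψ : ℂ → ℂ} {p : ℂ} {x c : ℝ} (hc : 0 < c)
    (hp : ∀ r : ℝ, 0 < r → c ≤ ‖polar r x - p‖) (hb : Summable fun n => ‖b n‖ * c⁻¹ ^ (n + 1))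
    (hψ : IntegrableOn (fun r => ψ (polar r x)) (Ioi 0)) :
    (∀ n : ℕ, IntegrableOn (fun r => ((polar r x - p) ^ (n + 1))⁻¹ * ψ (polar r x)) (Ioi 0)) ∧
    HasSum (fun n => b n * rayIntegral (fun s => ((s - p) ^ (n + 1))⁻¹ * ψ s) x)
      (rayIntegral (fun s => principalPart b p s * ψ s) x) := by
  have hne : ∀ r : ℝ, 0 < r → polar r x - p ≠ 0 := fun r hr =>
    norm_pos_iff.1 (hc.trans_le (hp r hr))
  have hi : ∀ n : ℕ,
      IntegrableOn (fun r => ((polar r x - p) ^ (n + 1))⁻¹ * ψ (polar r x)) (Ioi 0) := by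
    intro n
    refine integrableOn_mul_of_bound (g := fun s => ((s - p) ^ (n + 1))⁻¹) (B := c⁻¹ ^ (n + 1))
      (fun r hr => ?_) (fun r hr => ?_) hψ
    · have := pow_ne_zero (n + 1) (hne r hr)
      fun_prop (disch := assumption)
    · have := norm_div_pow_le (b := 1) hc (hp r hr) n
      simpa using this
  refine ⟨hi, ?_⟩
  have key := hasSum_integral_of_summable_integral_norm (μ := volume.restrict (Ioi (0 : ℝ)))
    (F := fun n r => b n * (((polar r x - p) ^ (n + 1))⁻¹ * ψ (polar r x) *
      Complex.exp (Complex.I * x))) (fun n => ((hi n).mul_const _).const_mul _) ?_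
  · convert! key using 1
    · funext n
      rw [integral_const_mul, rayIntegral]
    · rw [rayIntegral]
      congr 1
      funext r
      rw [principalPart, mul_assoc, ← tsum_mul_right]
      simp only [div_eq_mul_inv, mul_assoc]
  · refine Summable.of_nonneg_of_le (fun n => integral_nonneg fun r => norm_nonneg _) (fun n => ?_)
      (hb.mul_right (∫ r in Ioi (0 : ℝ), ‖ψ (polar r x)‖))
    rw [← integral_const_mul]
    refine integral_mono_of_nonneg (.of_forall fun r => norm_nonneg _) (hψ.norm.const_mul _)
      ((ae_restrict_iff' measurableSet_Ioi).2 (.of_forall fun r hr => ?_))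
    have := norm_div_pow_le (b := b n) hc (hp r hr) n
    simp only [norm_mul, norm_exp_I_mul, mul_one]
    rw [← mul_assoc, ← norm_mul, ← div_eq_mul_inv]
    gcongr

/-- The formula for the simple pole holds for every pole `p + w` near `p`. Expanding `1/(s - p - w)`
in a geometric series in `w` and comparing coefficients with the Taylor series of `ψ` at `p` gives
all higher orders at once. -/
lemma jump_pow {dm dp s y C : ℝ} {ψ : ℂ → ℂ} (hs : 0 < s) (h1 : dm < y) (h2 : y < dp)
    (hlt : dp - dm < Real.pi)
    (hd : ∀ r x : ℝ, 0 ≤ r → dm ≤ x → x ≤ dp → DifferentiableAt ℂ ψ (polar r x))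
    (hb : ∀ r x : ℝ, 0 < r → dm ≤ x → x ≤ dp → ‖ψ (polar r x)‖ ≤ C / (1 + r ^ 2)) (n : ℕ) :
    rayIntegral (fun w => ((w - polar s y) ^ (n + 1))⁻¹ * ψ w) dp -
      rayIntegral (fun w => ((w - polar s y) ^ (n + 1))⁻¹ * ψ w) dm =
      -(2 * Real.pi * Complex.I) * (iteratedDeriv n ψ (polar s y) / n.factorial) := by
  have hdp := (h1.trans h2).le
  set p : ℂ := polar s y with hp
  have hp0 : p ≠ 0 := polar_ne_zero hs y
  have hdist : ∀ x, dm ≤ x → x ≤ dp → x ≠ y →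
      ∃ c : ℝ, 0 < c ∧ ∀ r : ℝ, 0 < r → c ≤ ‖polar r x - p‖ := by
    intro x hx1 hx2 hxy
    obtain ⟨c, hc, h⟩ := exists_dist_polar (β₁ := x) (β₂ := x) hp0 (by
      intro r x' hr ha hb
      rw [le_antisymm hb ha]
      refine polar_ne_polar hr hs hxy ?_
      rw [abs_lt]; constructor <;> linarith [Real.pi_pos])
    exact ⟨c, hc, fun r hr => h r x hr.le le_rfl le_rfl⟩
  have hray : ∀ x, dm ≤ x → x ≤ dp → x ≠ y → ∃ c : ℝ, 0 < c ∧ ∀ w : ℂ, ‖w‖ < c →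
      HasSum (fun n : ℕ => w ^ n * rayIntegral (fun s => ((s - p) ^ (n + 1))⁻¹ * ψ s) x)
        (rayIntegral (fun s => (s - (p + w))⁻¹ * ψ s) x) := by
    intro x hx1 hx2 hxy
    obtain ⟨c, hc, hdc⟩ := hdist x hx1 hx2 hxy
    refine ⟨c, hc, fun w hw => ?_⟩
    have hi := integrableOn_comp_polar (f := ψ) (fun r hr => hd r x hr.le hx1 hx2)
      (fun r hr => hb r x hr hx1 hx2)
    have := (hasSum_rayIntegral (b := fun n => w ^ n) hc hdc ?_ hi).2
    · convert! this using 1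
      refine rayIntegral_congr fun r hr => ?_
      congr 1
      have h0 : polar r x - p ≠ 0 := norm_pos_iff.1 (hc.trans_le (hdc r hr))
      have hq : ‖w / (polar r x - p)‖ < 1 := by
        rw [norm_div, div_lt_one (norm_pos_iff.2 h0)]
        exact hw.trans_le (hdc r hr)
      have hg := (hasSum_geometric_of_norm_lt_one hq).mul_right (polar r x - p)⁻¹
      have hne : polar r x - (p + w) ≠ 0 := by
        intro h
        have : w / (polar r x - p) = 1 := by rw [div_eq_one_iff_eq h0]; linear_combination -h
        rw [this] at hq; simp at hq
      have e : (1 - w / (polar r x - p))⁻¹ * (polar r x - p)⁻¹ = (polar r x - (p + w))⁻¹ := by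
        rw [← mul_inv, sub_mul, div_mul_cancel₀ _ h0, one_mul, sub_sub]
      rw [← e, ← hg.tsum_eq, principalPart]
      refine tsum_congr fun n => ?_
      rw [div_pow, pow_succ]
      field_simp
    · have : Summable fun n : ℕ => (‖w‖ * c⁻¹) ^ n * c⁻¹ :=
        (summable_geometric_of_lt_one (by positivity)
          (by rwa [← div_eq_mul_inv, div_lt_one hc])).mul_right _
      refine this.congr fun n => ?_
      rw [norm_pow, mul_pow, pow_succ, mul_assoc]
  obtain ⟨c₁, hc₁, H₁⟩ := hray dp hdp le_rfl h2.ne'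
  obtain ⟨c₂, hc₂, H₂⟩ := hray dm le_rfl hdp h1.ne
  -- The displaced pole `p + w` has to stay strictly between the two rays.
  have hopen : sector ((dm + dp) / 2) (dp - dm) ∈ 𝓝 (p + 0) := by
    rw [add_zero]
    exact (isOpen_sector _ _).mem_nhds (polar_mem_sector hs (by linarith) (by linarith))
  have hev : ∀ᶠ w in 𝓝 (0 : ℂ), HasSum (fun n : ℕ => w ^ n *
      (rayIntegral (fun w => ((w - p) ^ (n + 1))⁻¹ * ψ w) dp -
        rayIntegral (fun w => ((w - p) ^ (n + 1))⁻¹ * ψ w) dm))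
      ((fun s => -(2 * Real.pi * Complex.I) * ψ s) (p + w)) := by
    have hadd : Tendsto (fun w : ℂ => p + w) (𝓝 0) (𝓝 (p + 0)) := (continuous_const_add p).tendsto 0
    filter_upwards [Metric.ball_mem_nhds (0 : ℂ) hc₁, Metric.ball_mem_nhds (0 : ℂ) hc₂,
      hadd.eventually hopen] with w hw₁ hw₂ hw₃
    obtain ⟨s', y', hs', hy1, hy2, he⟩ := hw₃
    have h := (H₁ w (by simpa using hw₁)).sub (H₂ w (by simpa using hw₂))
    rw [he, jump_cauchy hs' (by linarith) (by linarith) hlt hd hb, ← he] at h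
    simpa only [mul_sub] using h
  have := coeff_eq_iteratedDeriv (f := fun s => -(2 * Real.pi * Complex.I) * ψ s) (x := p)
    (c := fun n => rayIntegral (fun w => ((w - p) ^ (n + 1))⁻¹ * ψ w) dp -
      rayIntegral (fun w => ((w - p) ^ (n + 1))⁻¹ * ψ w) dm) hev n
  rwa [iteratedDeriv_const_mul_field, mul_div_assoc] at this

/-- The jump of the integral of `principalPart b p * ψ` when the direction of integration crosses
the pole. -/
lemma jump_principalPart {dm dp s y C : ℝ} {ψ : ℂ → ℂ} {b : ℕ → ℂ} (hb' : RapidDecay b)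
    (hs : 0 < s) (h1 : dm < y) (h2 : y < dp) (hlt : dp - dm < Real.pi)
    (hd : ∀ r x : ℝ, 0 ≤ r → dm ≤ x → x ≤ dp → DifferentiableAt ℂ ψ (polar r x))
    (hb : ∀ r x : ℝ, 0 < r → dm ≤ x → x ≤ dp → ‖ψ (polar r x)‖ ≤ C / (1 + r ^ 2)) :
    (∀ x, dm ≤ x → x ≤ dp → x ≠ y →
      IntegrableOn (fun r => principalPart b (polar s y) (polar r x) * ψ (polar r x)) (Ioi 0) ∧
      ∀ n : ℕ, IntegrableOn (fun r => ((polar r x - polar s y) ^ (n + 1))⁻¹ * ψ (polar r x))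
        (Ioi 0)) ∧
    HasSum (fun n : ℕ => b n *
        (-(2 * Real.pi * Complex.I) * (iteratedDeriv n ψ (polar s y) / n.factorial)))
      (rayIntegral (fun w => principalPart b (polar s y) w * ψ w) dp -
        rayIntegral (fun w => principalPart b (polar s y) w * ψ w) dm) := by
  have hdp := (h1.trans h2).le
  set p : ℂ := polar s y with hp
  have hp0 : p ≠ 0 := polar_ne_zero hs y
  have hdist : ∀ x, dm ≤ x → x ≤ dp → x ≠ y →
      ∃ c : ℝ, 0 < c ∧ ∀ r : ℝ, 0 < r → c ≤ ‖polar r x - p‖ := by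
    intro x hx1 hx2 hxy
    obtain ⟨c, hc, h⟩ := exists_dist_polar (β₁ := x) (β₂ := x) hp0 (by
      intro r x' hr ha hb
      rw [le_antisymm hb ha]
      refine polar_ne_polar hr hs hxy ?_
      rw [abs_lt]; constructor <;> linarith [Real.pi_pos])
    exact ⟨c, hc, fun r hr => h r x hr.le le_rfl le_rfl⟩
  have hi : ∀ x, dm ≤ x → x ≤ dp → IntegrableOn (fun r => ψ (polar r x)) (Ioi 0) :=
    fun x hx1 hx2 => integrableOn_comp_polar (fun r hr => hd r x hr.le hx1 hx2)
      (fun r hr => hb r x hr hx1 hx2)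
  constructor
  · intro x hx1 hx2 hxy
    obtain ⟨c, hc, hdc⟩ := hdist x hx1 hx2 hxy
    obtain ⟨B, -, hB⟩ := hb'.exists_bound hc
    refine ⟨integrableOn_mul_of_bound (B := B) (fun r hr => hb'.differentiableAt ?_)
      (fun r hr => hB _ _ (hdc r hr)) (hi x hx1 hx2),
      (hasSum_rayIntegral hc hdc (hb' _ (inv_nonneg.2 hc.le)) (hi x hx1 hx2)).1⟩
    exact sub_ne_zero.1 (norm_pos_iff.1 (hc.trans_le (hdc r hr)))
  · obtain ⟨c₁, hc₁, hd₁⟩ := hdist dp hdp le_rfl h2.ne'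
    obtain ⟨c₂, hc₂, hd₂⟩ := hdist dm le_rfl hdp h1.ne
    have H := ((hasSum_rayIntegral hc₁ hd₁ (hb' _ (inv_nonneg.2 hc₁.le)) (hi dp hdp le_rfl)).2).sub
      ((hasSum_rayIntegral hc₂ hd₂ (hb' _ (inv_nonneg.2 hc₂.le)) (hi dm le_rfl hdp)).2)
    refine H.congr_fun fun n => ?_
    rw [← mul_sub, jump_pow hs h1 h2 hlt hd hb n]

/-! ### Identity theorems on sectors -/

/-- The punctured set is the union of its intersections with the four open half-planes to the right,
above, to the left and below `p`. These are convex, and neighbouring ones meet at points `p +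
(e/2)(±1 ± i)` of a small disc around `p`. -/
lemma isPreconnected_diff_singleton {V : Set ℂ} (hV : IsOpen V) (hc : Convex ℝ V) (p : ℂ) :
    IsPreconnected (V \ {p}) := by
  by_cases hp : p ∈ V
  swap
  · rw [sdiff_singleton_eq_self hp]; exact hc.isPreconnected
  obtain ⟨e, he, hball⟩ := Metric.isOpen_iff.1 hV p hp
  have hmem : ∀ v : ℂ, ‖v‖ < 2 → p + (e / 2 : ℝ) * v ∈ V := by
    intro v hv
    apply hball
    rw [mem_ball_iff_norm, add_sub_cancel_left, norm_mul, Complex.norm_real,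
      Real.norm_of_nonneg (by positivity)]
    nlinarith
  have hn : ‖1 + Complex.I‖ < 2 ∧ ‖1 - Complex.I‖ < 2 ∧ ‖-1 + Complex.I‖ < 2 := by
    refine ⟨?_, ?_, ?_⟩ <;>
    · rw [← sq_lt_sq₀ (norm_nonneg _) (by norm_num), Complex.sq_norm, Complex.normSq_apply]
      norm_num
  have hre : Convex ℝ {w : ℂ | p.re < w.re} := convex_halfSpace_re_gt _
  have hre' : Convex ℝ {w : ℂ | w.re < p.re} := convex_halfSpace_re_lt _
  have him : Convex ℝ {w : ℂ | p.im < w.im} := convex_halfSpace_im_gt _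
  have him' : Convex ℝ {w : ℂ | w.im < p.im} := convex_halfSpace_im_lt _
  have h12 := IsPreconnected.union' (s := V ∩ {w : ℂ | p.im < w.im})
    (t := V ∩ {w : ℂ | p.re < w.re})
    ⟨p + (e / 2 : ℝ) * (1 + Complex.I), ⟨hmem _ hn.1, by simp [he]⟩, hmem _ hn.1, by simp [he]⟩
    (hc.inter him).isPreconnected (hc.inter hre).isPreconnected
  have h34 := IsPreconnected.union' (s := V ∩ {w : ℂ | w.re < p.re})
    (t := V ∩ {w : ℂ | p.im < w.im})
    ⟨p + (e / 2 : ℝ) * (-1 + Complex.I), ⟨hmem _ hn.2.2, by simp [he]⟩, hmem _ hn.2.2,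
      by simp [he]⟩
    (hc.inter hre').isPreconnected (hc.inter him).isPreconnected
  have h123 := IsPreconnected.union' (t := V ∩ {w : ℂ | w.im < p.im})
    ⟨p + (e / 2 : ℝ) * (1 - Complex.I), Or.inr ⟨hmem _ hn.2.1, by simp [he]⟩, hmem _ hn.2.1,
      by simp [he]⟩
    h12 (hc.inter him').isPreconnected
  have h := IsPreconnected.union'
    ⟨p + (e / 2 : ℝ) * (-1 + Complex.I), Or.inr ⟨hmem _ hn.2.2, by simp [he]⟩,
      Or.inl (Or.inl ⟨hmem _ hn.2.2, by simp [he]⟩)⟩ h34 h123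
  convert! h using 1
  ext w
  simp only [Set.mem_sdiff, mem_singleton_iff, mem_union, mem_inter_iff, mem_ofPred_eq]
  constructor
  · rintro ⟨hw, hne⟩
    by_contra! hcon
    apply hne
    obtain ⟨⟨h1, h2⟩, ⟨-, h3⟩, h4⟩ := hcon
    exact Complex.ext (le_antisymm (h3 hw) (h1 hw)) (le_antisymm (h2 hw) (h4 hw))
  · rintro ((⟨hw, h⟩ | ⟨hw, h⟩) | (⟨hw, h⟩ | ⟨hw, h⟩) | ⟨hw, h⟩) <;>
    · refine ⟨hw, ?_⟩
      rintro rfl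
      exact lt_irrefl _ h

/-- A thin neighbourhood of the segment is convex, so analytic continuation from `0` to `q` can be
compared there whatever the shape of `U`; in particular a sector may have opening larger than `2π`.
-/
lemma exists_convex_subset {U : Set ℂ} (hU : IsOpen U) {q : ℂ} (hq : segment ℝ 0 q ⊆ U) :
    ∃ V : Set ℂ, IsOpen V ∧ Convex ℝ V ∧ 0 ∈ V ∧ q ∈ V ∧ V ⊆ U := by
  have hK : IsCompact (segment ℝ (0 : ℂ) q) := by
    rw [segment_eq_image']
    exact isCompact_Icc.image (by fun_prop)
  obtain ⟨δ, hδ, h⟩ := hK.exists_thickening_subset_open hU hq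
  exact ⟨_, Metric.isOpen_thickening, (convex_segment _ _).thickening δ,
    Metric.self_subset_thickening hδ _ (left_mem_segment ℝ _ _),
    Metric.self_subset_thickening hδ _ (right_mem_segment ℝ _ _), h⟩

lemma eqOn_of_differentiableOn {V : Set ℂ} {g h : ℂ → ℂ} (hV : IsOpen V) (hc : IsPreconnected V)
    (h0 : 0 ∈ V) (hg : DifferentiableOn ℂ g V) (hh : DifferentiableOn ℂ h V)
    (he : g =ᶠ[𝓝 0] h) : EqOn g h V :=
  (hg.analyticOnNhd hV).eqOn_of_preconnected_of_eventuallyEq (hh.analyticOnNhd hV) hc h0 he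

lemma mem_segment_polar {r x : ℝ} (hr : 0 < r) {w : ℂ} (hw : w ∈ segment ℝ 0 (polar r x)) :
    w = 0 ∨ ∃ t : ℝ, 0 < t ∧ t ≤ r ∧ w = polar t x := by
  rw [segment_eq_image'] at hw
  obtain ⟨t, ⟨h0, h1⟩, rfl⟩ := hw
  rcases h0.eq_or_lt with rfl | h0
  · left; simp
  · right
    refine ⟨t * r, by positivity, by nlinarith, ?_⟩
    simp [polar, mul_assoc]

lemma segment_polar_subset_hatSector {d ε ρ r x : ℝ} (hρ : 0 < ρ) (hr : 0 < r)
    (h1 : d - ε / 2 < x) (h2 : x < d + ε / 2) : segment ℝ 0 (polar r x) ⊆ hatSector d ε ρ := by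
  intro w hw
  rcases mem_segment_polar hr hw with rfl | ⟨t, ht, -, rfl⟩
  · exact Or.inl (Metric.mem_ball_self hρ)
  · exact Or.inr (polar_mem_sector ht h1 h2)

/-! ### The even part of a function as a function of the square of the variable -/

/-- The function `s ↦ (f (√s) + f (-√s)) / 2`. -/
def evenPart (f : ℂ → ℂ) (s : ℂ) : ℂ := (f (s ^ (1 / 2 : ℂ)) + f (-s ^ (1 / 2 : ℂ))) / 2

lemma cpow_half_sq (s : ℂ) : (s ^ (1 / 2 : ℂ)) ^ 2 = s := by
  rw [one_div, show (2 : ℂ) = ((2 : ℕ) : ℂ) by norm_num, Complex.cpow_nat_inv_pow s two_ne_zero]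

lemma norm_cpow_half (s : ℂ) : ‖s ^ (1 / 2 : ℂ)‖ ^ 2 = ‖s‖ := by
  rw [← norm_pow, cpow_half_sq]

/-- The even part does not depend on the choice of the square root. -/
lemma evenPart_sq (f : ℂ → ℂ) (w : ℂ) : evenPart f (w ^ 2) = (f w + f (-w)) / 2 := by
  rcases sq_eq_sq_iff_eq_or_eq_neg.1 (cpow_half_sq (w ^ 2)) with h | h
  · rw [evenPart, h]
  · rw [evenPart, h, neg_neg, add_comm]

/-- The odd Taylor terms of `f(w)` and `f(-w)` cancel, and the even ones are powers of `w² = s`. -/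
lemma evenPart_hasSum {f : ℂ → ℂ} {p s : ℂ} (hf : DifferentiableOn ℂ f {p}ᶜ)
    (hs : ‖s‖ < ‖p‖ ^ 2) :
    HasSum (fun n : ℕ => iteratedDeriv (2 * n) f 0 / (2 * n).factorial * s ^ n)
      (evenPart f s) := by
  set w := s ^ (1 / 2 : ℂ) with hw
  have hwp : ‖w‖ < ‖p‖ := by
    rw [← norm_cpow_half s] at hs
    exact lt_of_pow_lt_pow_left₀ 2 (norm_nonneg p) hs
  have hball : DifferentiableOn ℂ f (Metric.ball 0 ‖p‖) := hf.mono fun v hv => by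
    rintro rfl
    simp at hv
  have h1 := hasSum_taylor hball hwp
  have h2 := hasSum_taylor hball (w := -w) (by rwa [norm_neg])
  rw [zero_add] at h1 h2
  have h3 := (h1.add h2).div_const 2
  have hinj : Function.Injective fun n : ℕ => 2 * n := fun m n h => by simpa using h
  rw [← hinj.hasSum_iff] at h3
  · refine h3.congr_fun fun n => ?_
    simp only [Function.comp_apply]
    rw [Even.neg_pow (even_two_mul n), pow_mul, hw, cpow_half_sq]
    ring
  · intro m hm
    have : Odd m := by
      rw [← Nat.not_even_iff_odd]
      rintro ⟨k, rfl⟩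
      exact hm ⟨k, by simp only; ring⟩
    rw [this.neg_pow]
    ring

lemma evenPart_differentiableAt {f : ℂ → ℂ} {p s : ℂ} (hp : p ≠ 0)
    (hf : DifferentiableOn ℂ f {p}ᶜ) (hs : s ≠ p ^ 2) : DifferentiableAt ℂ (evenPart f) s := by
  have hE : ∀ w : ℂ, w ^ 2 ≠ p ^ 2 → DifferentiableAt ℂ (fun w => (f w + f (-w)) / 2) w := by
    intro w hw
    have h1 : DifferentiableAt ℂ f w := hf.differentiableAt
      (isOpen_compl_singleton.mem_nhds (by rintro rfl; exact hw rfl))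
    have h2 : DifferentiableAt ℂ f (-w) := hf.differentiableAt
      (isOpen_compl_singleton.mem_nhds (by intro h; exact hw (by rw [← mem_singleton_iff.1 h, neg_sq])))
    exact (h1.add (h2.comp w differentiableAt_id.neg)).div_const 2
  -- At the branch point holomorphy comes from the power series; elsewhere it comes from a
  -- holomorphic branch of the root.
  rcases eq_or_ne s 0 with rfl | hs0
  · refine (analyticAt_of_hasSum (c := fun n => iteratedDeriv (2 * n) f 0 / (2 * n).factorial)
      ?_).differentiableAt
    filter_upwards [Metric.ball_mem_nhds (0 : ℂ) (show 0 < ‖p‖ ^ 2 by positivity)] with w hw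
    rw [zero_add]
    simpa only [mul_comm] using evenPart_hasSum hf (by simpa using hw)
  by_cases hslit : s ∈ Complex.slitPlane
  · have h1 : DifferentiableAt ℂ (fun s : ℂ => s ^ (1 / 2 : ℂ)) s :=
      differentiableAt_id.cpow_const hslit
    exact (hE _ (by rwa [cpow_half_sq])).comp s h1
  -- On the cut of the principal root the branch `i √(-s)` is holomorphic and gives the same even
  -- part.
  · have hslit' : -s ∈ Complex.slitPlane := by
      rw [Complex.mem_slitPlane_iff] at hslit ⊢
      push Not at hslit
      left
      rw [Complex.neg_re]
      have : s.re ≠ 0 := fun h => hs0 (Complex.ext h hslit.2)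
      have := lt_of_le_of_ne hslit.1 this
      linarith
    have hsq : ∀ s : ℂ, (Complex.I * (-s) ^ (1 / 2 : ℂ)) ^ 2 = s := by
      intro s
      rw [mul_pow, cpow_half_sq, Complex.I_sq]
      ring
    have h1 : DifferentiableAt ℂ (fun s : ℂ => Complex.I * (-s) ^ (1 / 2 : ℂ)) s :=
      (differentiableAt_id.neg.cpow_const hslit').const_mul _
    have h2 := (hE _ (by rwa [hsq])).comp s h1
    refine h2.congr_of_eventuallyEq (.of_forall fun v => ?_)
    rw [Function.comp_apply, ← evenPart_sq, hsq]

/-- `f` is the sum of the principal part with coefficients `b` at `p` and an entire function that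
grows at most like `exp (B |w|²)`. -/
structure HasPole (f : ℂ → ℂ) (b : ℕ → ℂ) (p : ℂ) (Q : ℂ → ℂ) (A B : ℝ) : Prop where
  ne_zero : p ≠ 0
  rapid : RapidDecay b
  A_pos : 0 < A
  B_pos : 0 < B
  entire : Differentiable ℂ Q
  bound : ∀ w, ‖Q w‖ ≤ A * Real.exp (B * ‖w‖ ^ 2)
  eq : ∀ w, w ≠ p → f w = principalPart b p w + Q w

namespace HasPole

variable {f : ℂ → ℂ} {b : ℕ → ℂ} {p : ℂ} {Q : ℂ → ℂ} {A B : ℝ}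

lemma differentiableAt (h : HasPole f b p Q A B) {w : ℂ} (hw : w ≠ p) :
    DifferentiableAt ℂ f w := by
  refine ((h.rapid.differentiableAt hw).add h.entire.differentiableAt).congr_of_eventuallyEq ?_
  filter_upwards [isOpen_ne.mem_nhds hw] with v hv using h.eq v hv

lemma differentiableOn (h : HasPole f b p Q A B) : DifferentiableOn ℂ f {p}ᶜ := fun _ hw =>
  (h.differentiableAt hw).differentiableWithinAt

lemma bound_of_dist (h : HasPole f b p Q A B) {c : ℝ} (hc : 0 < c) :
    ∃ A' : ℝ, 0 < A' ∧ ∀ w, c ≤ ‖w - p‖ → ‖f w‖ ≤ A' * Real.exp (B * ‖w‖ ^ 2) := by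
  obtain ⟨M, hM, hMb⟩ := h.rapid.exists_bound hc
  refine ⟨M + A, add_pos hM h.A_pos, fun w hw => ?_⟩
  have hne : w ≠ p := sub_ne_zero.1 (norm_pos_iff.1 (hc.trans_le hw))
  rw [h.eq w hne, add_mul]
  refine (norm_add_le _ _).trans (add_le_add ((hMb _ _ hw).trans ?_) (h.bound w))
  have : 1 ≤ Real.exp (B * ‖w‖ ^ 2) := Real.one_le_exp (by have := h.B_pos; positivity)
  nlinarith

lemma evenPart_bound (h : HasPole f b p Q A B) {c : ℝ} (hc : 0 < c) :
    ∃ A' : ℝ, 0 < A' ∧ ∀ s, c ≤ ‖s - p ^ 2‖ → ‖evenPart f s‖ ≤ A' * Real.exp (B * ‖s‖) := by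
  have hp : 0 < ‖p‖ := norm_pos_iff.2 h.ne_zero
  -- If `‖w - p‖ < 1`, then `‖w² - p²‖ ≤ ‖w - p‖ (1 + 2‖p‖)`. So distance `c` from `p²` forces
  -- distance `c'` from `p`, for both roots of `s`.
  set c' : ℝ := min 1 (c / (1 + 2 * ‖p‖)) with hc'
  have hc'0 : 0 < c' := lt_min one_pos (by positivity)
  obtain ⟨A', hA', hb⟩ := h.bound_of_dist hc'0
  have hfar : ∀ w : ℂ, c ≤ ‖w ^ 2 - p ^ 2‖ → c' ≤ ‖w - p‖ := by
    intro w hw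
    rcases le_or_gt 1 ‖w - p‖ with h1 | h1
    · exact (min_le_left _ _).trans h1
    · refine (min_le_right _ _).trans ?_
      rw [div_le_iff₀ (by positivity)]
      refine hw.trans ?_
      rw [show w ^ 2 - p ^ 2 = (w - p) * (w - p + 2 * p) by ring, norm_mul]
      gcongr
      refine (norm_add_le _ _).trans ?_
      rw [norm_mul, Complex.norm_ofNat]
      linarith
  refine ⟨A', hA', fun s hs => ?_⟩
  have h1 := hb _ (hfar (s ^ (1 / 2 : ℂ)) (by rwa [cpow_half_sq]))
  have h2 := hb _ (hfar (-s ^ (1 / 2 : ℂ)) (by rwa [neg_sq, cpow_half_sq]))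
  rw [norm_neg] at h2
  rw [norm_cpow_half] at h1 h2
  rw [evenPart, norm_div, Complex.norm_ofNat, div_le_iff₀ two_pos]
  refine (norm_add_le _ _).trans ?_
  linarith

end HasPole

/-! ### Summability in directions other than that of the singular point -/

/-- The coefficients `f⁽²ⁿ⁾(0) / n!` of the formal heat solution. -/
def IsHeatSeries (f : ℂ → ℂ) (F : PowerSeries ℂ) : Prop :=
  ∀ n : ℕ, PowerSeries.coeff n F = iteratedDeriv (2 * n) f 0 / n.factorial

/-- For `k = 1` the Gamma quotient is `n!/(2n)!`. The index is written `1 / (1 + 1)` to match `k /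
(k + 1)`. -/
lemma coeff_formalDeceleration {f : ℂ → ℂ} {F : PowerSeries ℂ} (hF : IsHeatSeries f F) (n : ℕ) :
    PowerSeries.coeff n (formalDeceleration 1 (1 / (1 + 1)) F) =
      iteratedDeriv (2 * n) f 0 / (2 * n).factorial := by
  rw [formalDeceleration, PowerSeries.coeff_mk, hF n]
  have h1 : Real.Gamma (1 + (n : ℝ) / 1) = n.factorial := by
    rw [div_one, add_comm, Real.Gamma_nat_eq_factorial]
  have h2 : Real.Gamma (1 + (n : ℝ) / (1 / (1 + 1))) = (2 * n).factorial := by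
    rw [← Real.Gamma_nat_eq_factorial]
    congr 1
    push_cast
    ring
  rw [h1, h2]
  have : (n.factorial : ℂ) ≠ 0 := Nat.cast_ne_zero.2 n.factorial_ne_zero
  push_cast
  field_simp

lemma hasSum_formalDeceleration {f : ℂ → ℂ} {p s : ℂ} {F : PowerSeries ℂ} (hF : IsHeatSeries f F)
    (hf : DifferentiableOn ℂ f {p}ᶜ) (hs : ‖s‖ < ‖p‖ ^ 2) :
    HasSum (fun n : ℕ => PowerSeries.coeff n (formalDeceleration 1 (1 / (1 + 1)) F) * s ^ n)
      (evenPart f s) := by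
  simp only [coeff_formalDeceleration hF]
  exact evenPart_hasSum hf hs

lemma HasPole.isContinuedDeceleration {f : ℂ → ℂ} {b : ℕ → ℂ} {Q : ℂ → ℂ} {A B σ y d : ℝ}
    {F : PowerSeries ℂ} (h : HasPole f b (polar σ y) Q A B) (hF : IsHeatSeries f F) (hσ : 0 < σ)
    (hd : (d : Real.Angle) ≠ (2 * y : ℝ)) : IsContinuedDeceleration 1 d F (evenPart f) := by
  have hp2 : 0 < σ ^ 2 := by positivity
  have hp0 := polar_ne_zero hp2 (2 * y)
  have hne1 : polar 1 d ≠ polar 1 (2 * y) := fun he =>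
    hd ((polar_eq_polar_iff one_pos one_pos).1 he).2
  -- Points of the unit circle express inequality of directions modulo `2π` as an open condition.
  -- The sector has half-opening `ε/2`, so its closure also avoids the singular direction.
  have hopen : ∀ᶠ x in 𝓝 d, polar 1 x ≠ polar 1 (2 * y) :=
    (show Continuous fun x => polar 1 x by fun_prop).continuousAt.eventually_ne hne1
  obtain ⟨ε, hε, hball⟩ := Metric.eventually_nhds_iff_ball.1 hopen
  obtain ⟨c, hc, hdist⟩ := exists_dist_polar (β₁ := d - ε / 2) (β₂ := d + ε / 2) hp0 (by
    intro r x hr h1 h2 he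
    have hx : x ∈ Metric.ball d ε := by
      rw [Metric.mem_ball, Real.dist_eq, abs_lt]
      constructor <;> linarith
    exact hball x hx ((polar_eq_polar_iff one_pos one_pos).2
      ⟨rfl, ((polar_eq_polar_iff hr hp2).1 he).2⟩))
  have hfar : ∀ s ∈ hatSector d ε (σ ^ 2 / 2), min c (σ ^ 2 / 2) ≤ ‖s - polar σ y ^ 2‖ := by
    rintro s (hs | ⟨r, x, hr, h1, h2, rfl⟩)
    · refine (min_le_right _ _).trans ?_
      rw [mem_ball_zero_iff] at hs
      have := norm_sub_norm_le (polar σ y ^ 2) s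
      rw [norm_pow, norm_polar hσ.le, norm_sub_rev] at this
      linarith
    · rw [polar_sq]
      exact (min_le_left _ _).trans (hdist r x hr.le h1.le h2.le)
  have hmin : 0 < min c (σ ^ 2 / 2) := lt_min hc (by positivity)
  refine ⟨ε, σ ^ 2 / 2, hε, by positivity, ⟨fun s hs => ?_, fun β₁ β₂ hβ => ?_⟩, fun s hs => ?_⟩
  · have := hmin.trans_le (hfar s hs)
    exact (evenPart_differentiableAt h.ne_zero h.differentiableOn
      (sub_ne_zero.1 (norm_pos_iff.1 this))).differentiableWithinAt
  · obtain ⟨A', hA', hb⟩ := h.evenPart_bound hmin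
    refine ⟨A', B, hA', h.B_pos, fun r x hr h1 h2 => ?_⟩
    rw [Real.rpow_one]
    have := hb _ (hfar _ (hβ r x hr h1 h2))
    rwa [norm_polar hr.le] at this
  · refine hasSum_formalDeceleration hF h.differentiableOn ?_
    rw [norm_polar hσ.le]
    rw [mem_ball_zero_iff] at hs
    linarith

lemma HasPole.eventuallyEq {f : ℂ → ℂ} {b : ℕ → ℂ} {Q g : ℂ → ℂ} {A B ρ : ℝ} {p : ℂ}
    {F : PowerSeries ℂ} (h : HasPole f b p Q A B) (hF : IsHeatSeries f F) (hρ : 0 < ρ)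
    (hg : ∀ s ∈ Metric.ball (0 : ℂ) ρ, HasSum (fun n : ℕ =>
      PowerSeries.coeff n (formalDeceleration 1 (1 / (1 + 1)) F) * s ^ n) (g s)) :
    g =ᶠ[𝓝 0] evenPart f := by
  have hp : 0 < ‖p‖ := norm_pos_iff.2 h.ne_zero
  filter_upwards [Metric.ball_mem_nhds (0 : ℂ) hρ,
    Metric.ball_mem_nhds (0 : ℂ) (show 0 < ‖p‖ ^ 2 by positivity)] with s hs hs'
  exact (hg s hs).unique (hasSum_formalDeceleration hF h.differentiableOn (by simpa using hs'))

/-- The continuation is a chosen one. It agrees with the even part near `0`, hence along the ray by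
the identity theorem, since the ray avoids the singular point `p²`. -/
lemma HasPole.continuedDeceleration_eq {f : ℂ → ℂ} {b : ℕ → ℂ} {Q : ℂ → ℂ} {A B σ y d : ℝ}
    {F : PowerSeries ℂ} (h : HasPole f b (polar σ y) Q A B) (hF : IsHeatSeries f F) (hσ : 0 < σ)
    (hd : (d : Real.Angle) ≠ (2 * y : ℝ)) {r : ℝ} (hr : 0 < r) :
    continuedDeceleration 1 d F (polar r d) = evenPart f (polar r d) := by
  have hsum : KSummable 1 d F := ⟨_, h.isContinuedDeceleration hF hσ hd⟩
  rw [continuedDeceleration, dif_pos hsum]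
  obtain ⟨ε, ρ, hε, hρ, ⟨hdiff, -⟩, hg⟩ := hsum.choose_spec
  have hp2 : 0 < σ ^ 2 := by positivity
  obtain ⟨V, hV, hVc, h0, hmem, hsub⟩ := exists_convex_subset (q := polar r d)
    ((isOpen_hatSector d ε ρ).sdiff (isClosed_singleton (x := polar σ y ^ 2))) (by
      intro w hw
      refine ⟨segment_polar_subset_hatSector hρ hr (by linarith) (by linarith) hw, ?_⟩
      rw [mem_singleton_iff, polar_sq]
      rcases mem_segment_polar hr hw with rfl | ⟨t, ht, -, rfl⟩
      · exact (polar_ne_zero hp2 _).symm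
      · exact fun he => hd ((polar_eq_polar_iff ht hp2).1 he).2)
  exact eqOn_of_differentiableOn hV hVc.isPreconnected h0
    (hdiff.mono fun s hs => (hsub hs).1)
    (fun s hs => (evenPart_differentiableAt h.ne_zero h.differentiableOn
      (hsub hs).2).differentiableWithinAt) (h.eventuallyEq hF hρ hg) hmem

/-- If the direction of the singular point is not singular, then the principal part vanishes. -/
lemma HasPole.eq_zero_of_kSummable {f : ℂ → ℂ} {b : ℕ → ℂ} {Q : ℂ → ℂ} {A B σ y : ℝ}
    {F : PowerSeries ℂ} (h : HasPole f b (polar σ y) Q A B) (hF : IsHeatSeries f F) (hσ : 0 < σ)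
    (hsum : KSummable 1 (2 * y) F) : b = 0 := by
  obtain ⟨g, ε, ρ, hε, hρ, ⟨hdiff, -⟩, hg⟩ := hsum
  set p := polar σ y with hp
  have hp0 : p ≠ 0 := h.ne_zero
  have hp2 : 0 < σ ^ 2 := by positivity
  obtain ⟨V, hV, hVc, h0, hmem, hsub⟩ := exists_convex_subset (q := p ^ 2)
    (isOpen_hatSector (2 * y) ε ρ) (by
      rw [hp, polar_sq]
      exact segment_polar_subset_hatSector hρ hp2 (by linarith) (by linarith))
  have heq : EqOn g (evenPart f) (V \ {p ^ 2}) :=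
    eqOn_of_differentiableOn (hV.sdiff isClosed_singleton) (isPreconnected_diff_singleton hV hVc _)
      ⟨h0, (pow_ne_zero 2 hp0).symm⟩ (hdiff.mono fun s hs => hsub hs.1)
      (fun s hs => (evenPart_differentiableAt hp0 h.differentiableOn hs.2).differentiableWithinAt)
      (h.eventuallyEq hF hρ hg)
  have hpneg : -p ≠ p := by
    intro he
    exact hp0 (self_eq_neg.1 he.symm)
  -- Off `p` this function equals the principal part. It is continuous at `p`, because `g` continues
  -- to `p²` and `f(-w)` is singular only at `-p ≠ p`.
  have hcont : ContinuousAt (fun w => 2 * g (w ^ 2) - f (-w) - Q w) p := by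
    have h1 : ContinuousAt g (p ^ 2) :=
      (hdiff.differentiableAt ((isOpen_hatSector _ _ _).mem_nhds (hsub hmem))).continuousAt
    have h2 : ContinuousAt (fun w => g (w ^ 2)) p :=
      ContinuousAt.comp (f := fun w : ℂ => w ^ 2) h1 (continuous_pow 2).continuousAt
    have h3 : ContinuousAt (fun w => f (-w)) p :=
      ContinuousAt.comp (f := fun w : ℂ => -w) (h.differentiableAt hpneg).continuousAt
        continuous_neg.continuousAt
    exact ((continuousAt_const.mul h2).sub h3).sub h.entire.continuous.continuousAt
  have hev : ∀ᶠ w in 𝓝 p, w ≠ p → ‖principalPart b p w‖ ≤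
      ‖2 * g (p ^ 2) - f (-p) - Q p‖ + 1 := by
    have hsq : ∀ᶠ w in 𝓝 p, w ^ 2 ∈ V :=
      (continuous_pow 2).continuousAt.eventually (hV.mem_nhds hmem)
    filter_upwards [hsq, isOpen_ne.mem_nhds hpneg.symm,
      hcont.norm.eventually (gt_mem_nhds (lt_add_one _))] with w hw hw' hw'' hne
    have hsq' : w ^ 2 ≠ p ^ 2 := fun he => (sq_eq_sq_iff_eq_or_eq_neg.1 he).elim hne hw'
    have e := heq ⟨hw, hsq'⟩
    rw [evenPart_sq, h.eq w hne] at e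
    have : principalPart b p w = 2 * g (w ^ 2) - f (-w) - Q w := by
      rw [e]; ring
    rw [this]
    exact hw''.le
  obtain ⟨c, hc, hball⟩ := Metric.eventually_nhds_iff_ball.1 hev
  exact h.rapid.eq_zero_of_bounded hc fun s hs hs' => hball s (by rwa [mem_ball_iff_norm]) hs

/-! ### The Ecalle kernel of index `2` -/

/-- These are the denominators of the even coefficients of the kernel; the functional equation of
`Γ` yields the induction. -/
lemma inv_factorial_mul_Gamma (m : ℕ) :
    ((2 * m).factorial : ℝ) * Real.Gamma (1 / 2 - m) =
      (-4) ^ m * m.factorial * Real.sqrt Real.pi := by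
  induction m with
  | zero => simp [Real.Gamma_one_half_eq, -one_div]
  | succ m ih =>
    have hne : (-1 / 2 - m : ℝ) ≠ 0 := by
      have : (0 : ℝ) ≤ m := m.cast_nonneg
      linarith
    have h1 : Real.Gamma (1 / 2 - m) = (-1 / 2 - m) * Real.Gamma (1 / 2 - (m + 1 : ℕ)) := by
      rw [show (1 / 2 - m : ℝ) = (-1 / 2 - m) + 1 by ring, Real.Gamma_add_one hne]
      congr 2
      push_cast
      ring
    have h2 : ((2 * (m + 1)).factorial : ℝ) = (2 * m + 2) * (2 * m + 1) * (2 * m).factorial := by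
      rw [show 2 * (m + 1) = 2 * m + 1 + 1 by ring, Nat.factorial_succ, Nat.factorial_succ]
      push_cast
      ring
    rw [h1] at ih
    rw [h2, Nat.factorial_succ, pow_succ]
    push_cast at ih ⊢
    linear_combination (-4) * (m + 1 : ℝ) * ih

/-- At an odd index `2m + 1` the argument of `Γ` is the pole `-m`, so the term vanishes. The even
terms form the exponential series of `-τ²/4`. -/
lemma ecalleKernel_two (τ : ℂ) :
    ecalleKernel 2 τ = Complex.exp (-τ ^ 2 / 4) / (Real.sqrt Real.pi : ℂ) := by
  have hpi : (Real.sqrt Real.pi : ℂ) ≠ 0 := by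
    rw [Ne, Complex.ofReal_eq_zero]; positivity
  have heven : HasSum (fun m : ℕ => (-τ) ^ (2 * m) / (((2 * m).factorial : ℂ) *
      (Real.Gamma (1 - (((2 * m : ℕ) : ℝ) + 1) / 2) : ℂ)))
      (Complex.exp (-τ ^ 2 / 4) / (Real.sqrt Real.pi : ℂ)) := by
    have := (NormedSpace.expSeries_div_hasSum_exp (-τ ^ 2 / 4)).div_const (Real.sqrt Real.pi : ℂ)
    rw [← Complex.exp_eq_exp_ℂ] at this
    refine this.congr_fun fun m => ?_
    rw [show (1 - (((2 * m : ℕ) : ℝ) + 1) / 2) = 1 / 2 - m by push_cast; ring]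
    have h := congrArg (fun x : ℝ => (x : ℂ)) (inv_factorial_mul_Gamma m)
    simp only [Complex.ofReal_mul, Complex.ofReal_natCast] at h
    rw [h, Even.neg_pow (even_two_mul m), pow_mul]
    push_cast
    have h4 : (-τ ^ 2 / 4) ^ m = (τ ^ 2) ^ m / (-4) ^ m := by
      rw [← div_pow]; congr 1; ring
    rw [h4, div_div, div_div, mul_assoc]
  have hodd : HasSum (fun m : ℕ => (-τ) ^ (2 * m + 1) / (((2 * m + 1).factorial : ℂ) *
      (Real.Gamma (1 - (((2 * m + 1 : ℕ) : ℝ) + 1) / 2) : ℂ))) 0 := by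
    refine hasSum_zero.congr_fun fun m => ?_
    rw [show (1 - (((2 * m + 1 : ℕ) : ℝ) + 1) / 2) = -(m : ℝ) by push_cast; ring,
      Real.Gamma_neg_nat_eq_zero]
    simp
  have h := HasSum.even_add_odd (f := fun n : ℕ => (-τ) ^ n / ((n.factorial : ℂ) *
    (Real.Gamma (1 - ((n : ℝ) + 1) / 2) : ℂ))) heven hodd
  rw [add_zero] at h
  exact h.tsum_eq

/-! ### The heat kernel -/

lemma norm_heatKernel {τ ψ v x : ℝ} (hτ : 0 < τ) :
    ‖heatKernel τ ψ (polar v x)‖ = (Real.sqrt (4 * Real.pi) * Real.sqrt τ)⁻¹ *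
      Real.exp (-(Real.cos (2 * x - ψ) / (4 * τ) * v ^ 2)) := by
  have h1 : -polar v x ^ 2 / (4 * polar τ ψ) = (-1) * polar (v ^ 2 / (4 * τ)) (2 * x - ψ) := by
    have h2 := polar_ne_zero hτ ψ
    have h3 : polar (v ^ 2 / (4 * τ)) (2 * x - ψ) * (4 * polar τ ψ) = polar (v ^ 2) (2 * x) := by
      rw [mul_left_comm, polar_mul, sub_add_cancel]
      simp only [polar]
      have : (τ : ℂ) ≠ 0 := Complex.ofReal_ne_zero.2 hτ.ne'
      push_cast
      field_simp
    rw [polar_sq, ← h3]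
    field_simp
  rw [heatKernel, norm_mul, norm_div, norm_one, norm_mul, norm_polar (Real.sqrt_nonneg _),
    Complex.norm_real, Real.norm_of_nonneg (Real.sqrt_nonneg _), one_div, Complex.norm_exp, h1,
    neg_one_mul, Complex.neg_re, polar_re]
  congr 3
  ring

lemma differentiable_heatKernel (τ ψ : ℝ) : Differentiable ℂ (heatKernel τ ψ) := by
  unfold heatKernel
  fun_prop

lemma exp_neg_mul_sq_le {a : ℝ} (ha : 0 < a) (v : ℝ) :
    Real.exp (-(a * v ^ 2)) ≤ max 1 a⁻¹ / (1 + v ^ 2) := by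
  rw [Real.exp_neg, le_div_iff₀ (by positivity), inv_mul_le_iff₀ (Real.exp_pos _)]
  have h1 := Real.add_one_le_exp (a * v ^ 2)
  have h2 : 1 ≤ max 1 a⁻¹ := le_max_left _ _
  have h3 : 1 ≤ a * max 1 a⁻¹ := by
    calc (1 : ℝ) = a * a⁻¹ := (mul_inv_cancel₀ ha.ne').symm
      _ ≤ _ := by gcongr; exact le_max_right _ _
  nlinarith [sq_nonneg v]

/-- A function that grows like `exp (B |w|²)` times a heat kernel that decays faster. -/
lemma norm_mul_heatKernel_le {g : ℂ} {M B κ τ ψ v x : ℝ} (hM : 0 ≤ M) (hτ : 0 < τ)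
    (hv : 0 ≤ v) (hκ : κ ≤ Real.cos (2 * x - ψ)) (hB : B < κ / (4 * τ))
    (hg : ‖g‖ ≤ M * Real.exp (B * ‖polar v x‖ ^ 2)) :
    ‖g * heatKernel τ ψ (polar v x)‖ ≤
      M * (Real.sqrt (4 * Real.pi) * Real.sqrt τ)⁻¹ * max 1 (κ / (4 * τ) - B)⁻¹ / (1 + v ^ 2) := by
  rw [norm_polar hv] at hg
  rw [norm_mul, norm_heatKernel hτ]
  have h1 : Real.exp (-(Real.cos (2 * x - ψ) / (4 * τ) * v ^ 2)) ≤
      Real.exp (-(κ / (4 * τ) * v ^ 2)) := by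
    gcongr
  calc ‖g‖ * ((Real.sqrt (4 * Real.pi) * Real.sqrt τ)⁻¹ *
        Real.exp (-(Real.cos (2 * x - ψ) / (4 * τ) * v ^ 2)))
      ≤ M * Real.exp (B * v ^ 2) * ((Real.sqrt (4 * Real.pi) * Real.sqrt τ)⁻¹ *
        Real.exp (-(κ / (4 * τ) * v ^ 2))) := by gcongr
    _ = M * (Real.sqrt (4 * Real.pi) * Real.sqrt τ)⁻¹ *
        Real.exp (-((κ / (4 * τ) - B) * v ^ 2)) := by
      rw [show -((κ / (4 * τ) - B) * v ^ 2) = B * v ^ 2 + -(κ / (4 * τ) * v ^ 2) by ring,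
        Real.exp_add]
      ring
    _ ≤ M * (Real.sqrt (4 * Real.pi) * Real.sqrt τ)⁻¹ *
        (max 1 (κ / (4 * τ) - B)⁻¹ / (1 + v ^ 2)) := by
      gcongr
      exact exp_neg_mul_sq_le (by linarith) v
    _ = _ := by ring

/-! ### The `1`-sum as an integral against the heat kernel -/

/-- The substitution `s = w²`. The kernel becomes the heat kernel, its `1/√π` combining with the
`1/2` of the even part and with `t^(-1/2)` to `1/√(4πt)`. The real factor in front is the Jacobian
of `r = x^(1/2)`. -/
lemma accelIntegrand_eq {f g : ℂ → ℂ} {d τ ψ x : ℝ} (hτ : 0 < τ) (hx : 0 < x)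
    (hg : g (polar x d) = evenPart f (polar x d)) :
    (polar (τ ^ (1 / (1 + 1) : ℝ)) ((1 / (1 + 1) : ℝ) * ψ))⁻¹ *
        accelIntegrand 1 (1 / (1 + 1)) d g τ ψ x =
      (|(1 / 2 : ℝ)| * x ^ ((1 / 2 : ℝ) - 1)) •
        ((f (polar (x ^ (1 / 2 : ℝ)) (d / 2)) + f (-polar (x ^ (1 / 2 : ℝ)) (d / 2))) *
          heatKernel τ ψ (polar (x ^ (1 / 2 : ℝ)) (d / 2)) *
          Complex.exp (Complex.I * (d / 2 : ℝ))) := by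
  have hpi : (Real.sqrt Real.pi : ℂ) ≠ 0 := by
    rw [Ne, Complex.ofReal_eq_zero]; positivity
  have hP : polar (Real.sqrt τ) (ψ / 2) ≠ 0 := polar_ne_zero (Real.sqrt_pos.2 hτ) _
  have hT : polar τ ψ ≠ 0 := polar_ne_zero hτ _
  have hhalf : (1 / (1 + 1) : ℝ) = 1 / 2 := by norm_num
  have hw : polar (x ^ (1 / 2 : ℝ)) (d / 2) ^ 2 = polar x d := by
    rw [polar_sq, ← Real.sqrt_eq_rpow, Real.sq_sqrt hx.le, mul_div_cancel₀ _ two_ne_zero]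
  have hk : polar ((x / τ) ^ (1 / 2 : ℝ)) (1 / 2 * (d - ψ)) ^ 2 = polar x d / polar τ ψ := by
    rw [eq_div_iff hT, polar_sq, ← Real.sqrt_eq_rpow, Real.sq_sqrt (by positivity), polar_mul,
      div_mul_cancel₀ _ hτ.ne']
    congr 1
    ring
  have h4 : Real.sqrt (4 * Real.pi) = 2 * Real.sqrt Real.pi := by
    rw [Real.sqrt_mul (by norm_num), show (4 : ℝ) = 2 ^ 2 by norm_num, Real.sqrt_sq (by norm_num)]
  rw [accelIntegrand, hg, ← hw, evenPart_sq, hhalf, show (1 / (1 / 2) : ℝ) = 2 by norm_num,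
    ecalleKernel_two, hk, ← hw, heatKernel, h4, ← Real.sqrt_eq_rpow τ,
    show (1 / 2 * ψ : ℝ) = ψ / 2 by ring, show (1 / 2 * d : ℝ) = d / 2 by ring,
    abs_of_pos (by norm_num : (0 : ℝ) < 1 / 2), neg_div, div_div, mul_comm (polar τ ψ) 4, neg_div,
    Complex.real_smul]
  simp only [polar] at hP ⊢
  push_cast
  field_simp

/-- The contributions of `f(w)` and `f(-w)` together form the classical heat integral over a full
line through `0`, rotated to direction `d/2`. -/
lemma kSum_eq_rayIntegral {f : ℂ → ℂ} {d τ ψ : ℝ} {F : PowerSeries ℂ} (hτ : 0 < τ)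
    (hg : ∀ x : ℝ, 0 < x →
      continuedDeceleration 1 d F (polar x d) = evenPart f (polar x d)) :
    kSum 1 d F τ ψ = rayIntegral (fun w => (f w + f (-w)) * heatKernel τ ψ w) (d / 2) := by
  rw [kSum, acceleration, ← integral_const_mul, rayIntegral,
    ← integral_comp_rpow_Ioi_of_pos (p := 1 / 2) (g := fun r => (f (polar r (d / 2)) +
      f (-polar r (d / 2))) * heatKernel τ ψ (polar r (d / 2)) *
        Complex.exp (Complex.I * (d / 2 : ℝ))) (by norm_num)]
  refine setIntegral_congr_fun measurableSet_Ioi fun x hx => ?_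
  rw [accelIntegrand_eq hτ hx (hg x hx), abs_of_pos (by norm_num : (0 : ℝ) < 1 / 2)]

lemma kSumConverges_of_integrableOn {f : ℂ → ℂ} {d τ ψ : ℝ} {F : PowerSeries ℂ} (hτ : 0 < τ)
    (hg : ∀ x : ℝ, 0 < x →
      continuedDeceleration 1 d F (polar x d) = evenPart f (polar x d))
    (hi : IntegrableOn (fun r => (f (polar r (d / 2)) + f (-polar r (d / 2))) *
      heatKernel τ ψ (polar r (d / 2))) (Ioi 0)) : KSumConverges 1 d F τ ψ := by
  have hP : polar (τ ^ (1 / (1 + 1) : ℝ)) ((1 / (1 + 1) : ℝ) * ψ) ≠ 0 :=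
    polar_ne_zero (Real.rpow_pos_of_pos hτ _) _
  have h1 : IntegrableOn (fun r => (f (polar r (d / 2)) + f (-polar r (d / 2))) *
      heatKernel τ ψ (polar r (d / 2)) * Complex.exp (Complex.I * (d / 2 : ℝ))) (Ioi 0) :=
    hi.mul_const _
  rw [← integrableOn_Ioi_comp_rpow_iff _ (by norm_num : (1 / 2 : ℝ) ≠ 0)] at h1
  have h2 := h1.const_mul (polar (τ ^ (1 / (1 + 1) : ℝ)) ((1 / (1 + 1) : ℝ) * ψ))
  refine IntegrableOn.congr_fun h2 (fun x hx => ?_) measurableSet_Ioi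
  rw [← accelIntegrand_eq hτ hx (hg x hx), mul_inv_cancel_left₀ hP]

/-! ### Defining functions of hyperfunctions -/

lemma HasPole.expGrowth {f : ℂ → ℂ} {b : ℕ → ℂ} {p : ℂ} {Q : ℂ → ℂ} {A B : ℝ}
    (h : HasPole f b p Q A B) {U : Set ℂ} (hU : p ∉ U) : ExpGrowth 2 U f := by
  refine ⟨h.differentiableOn.mono fun s hs => by rintro rfl; exact hU hs, fun β₁ β₂ hβ => ?_⟩
  obtain ⟨c, hc, hd⟩ := exists_dist_polar h.ne_zero fun r x hr h1 h2 he =>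
    hU (he ▸ hβ r x hr h1 h2)
  obtain ⟨A', hA', hb⟩ := h.bound_of_dist hc
  refine ⟨A', B, hA', h.B_pos, fun r x hr h1 h2 => ?_⟩
  have := hb _ (hd r x hr.le h1 h2)
  rwa [norm_polar hr.le, ← Real.rpow_two] at this

/-- Puts the summand `φ(z - s)` into the same framework, with its pole at the opposite point. -/
lemma HasPole.comp_neg {f : ℂ → ℂ} {b : ℕ → ℂ} {p : ℂ} {Q : ℂ → ℂ} {A B : ℝ}
    (h : HasPole f b p Q A B) :
    HasPole (fun w => f (-w)) (fun n => (-1) ^ (n + 1) * b n) (-p) (fun w => Q (-w)) A B where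
  ne_zero := neg_ne_zero.2 h.ne_zero
  rapid := fun M hM => by simpa using h.rapid M hM
  A_pos := h.A_pos
  B_pos := h.B_pos
  entire := h.entire.comp differentiable_neg
  bound := fun w => by simpa using h.bound (-w)
  eq := fun w hw => by
    rw [h.eq _ (fun he => hw (by rw [← he, neg_neg]))]
    congr 1
    refine tsum_congr fun n => ?_
    rw [show -w - p = -1 * (w - -p) by ring, mul_pow]
    have h1 : ((-1 : ℂ) ^ (n + 1)) * (-1) ^ (n + 1) = 1 := by
      rw [← mul_pow]; norm_num
    have h2 : ((-1 : ℂ) ^ (n + 1)) ≠ 0 := pow_ne_zero _ (by norm_num)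
    rw [div_mul_eq_div_div]
    congr 1
    rw [div_eq_iff h2]
    linear_combination -(b n) * h1

/-- An entire function has the zero principal part at any point, so the growth estimates for
functions with a pole cover it as well. -/
lemma HasPole.remainder {f : ℂ → ℂ} {b : ℕ → ℂ} {p : ℂ} {Q : ℂ → ℂ} {A B : ℝ}
    (h : HasPole f b p Q A B) {q : ℂ} (hq : q ≠ 0) : HasPole Q 0 q Q A B where
  ne_zero := hq
  rapid := fun M _ => by simp
  A_pos := h.A_pos
  B_pos := h.B_pos
  entire := h.entire
  bound := h.bound
  eq := fun w _ => by simp [principalPart]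

lemma RapidDecay.hasPole {b : ℕ → ℂ} (hb : RapidDecay b) {p : ℂ} (hp : p ≠ 0) :
    HasPole (principalPart b p) b p 0 1 1 where
  ne_zero := hp
  rapid := hb
  A_pos := one_pos
  B_pos := one_pos
  entire := differentiable_const 0
  bound := fun w => by simp; positivity
  eq := fun w _ => by simp

lemma isDefiningFunction_of_eqOn {k θ α ρ d : ℝ} {G : LaplaceHyperfunction k θ α ρ d}
    {g g' h : ℂ → ℂ} (hg : IsDefiningFunction G g) (hg' : ExpGrowth k (slitSector θ α ρ d) g')
    (hh : ExpGrowth k (hatSector θ α ρ) h)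
    (he : ∀ s ∈ slitSector θ α ρ d, g' s = g s + h s) : IsDefiningFunction G g' := by
  obtain ⟨hgm, rfl⟩ := hg
  refine ⟨hg', (Submodule.Quotient.eq _).2 ⟨h, hh, fun s hs => ?_⟩⟩
  change g' s - g s = h s
  rw [he s hs, add_sub_cancel_left]

lemma slitSector_subset (θ α ρ d : ℝ) : slitSector θ α ρ d ⊆ hatSector θ α ρ :=
  union_subset_union_right _ sdiff_subset

lemma polar_notMem_slitSector {θ α ρ σ d : ℝ} (hσ : 0 < σ) (hρ : ρ ≤ σ) :
    polar σ d ∉ slitSector θ α ρ d := by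
  rintro (h | ⟨-, h⟩)
  · rw [mem_ball_zero_iff, norm_polar hσ.le] at h
    linarith
  · exact h ⟨σ, hσ, rfl⟩

lemma neg_polar_notMem_hatSector {θ α ρ σ d : ℝ} (hσ : 0 < σ) (hρ : ρ ≤ σ) (hα : α < Real.pi)
    (h1 : θ - α / 2 < d) (h2 : d < θ + α / 2) : -polar σ d ∉ hatSector θ α ρ := by
  rintro (h | ⟨r, x, hr, h3, h4, h⟩)
  · rw [mem_ball_zero_iff, norm_neg, norm_polar hσ.le] at h
    linarith
  · refine polar_ne_neg_polar hr.le hσ ?_ h.symm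
    rw [abs_lt]; constructor <;> linarith

/-- The value of the hyperfunction defined by a principal part. -/
lemma hasPairing_principalPart {k θ α ρ σ d : ℝ} {G : LaplaceHyperfunction k θ α ρ d}
    {b : ℕ → ℂ} {ψ : ℂ → ℂ} (hb : RapidDecay b) (hσ : 0 < σ) (hα : α < Real.pi)
    (h1 : θ - α / 2 < d) (h2 : d < θ + α / 2)
    (hG : IsDefiningFunction G (principalPart b (polar σ d)))
    (hd : ∀ r x : ℝ, 0 ≤ r → θ - α / 2 < x → x < θ + α / 2 → DifferentiableAt ℂ ψ (polar r x))
    (hψ : ∀ β₁ β₂ : ℝ, θ - α / 2 < β₁ → β₂ < θ + α / 2 → ∃ C : ℝ,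
      ∀ r x : ℝ, 0 < r → β₁ ≤ x → x ≤ β₂ → ‖ψ (polar r x)‖ ≤ C / (1 + r ^ 2)) :
    ∃ v : ℂ, HasPairing G ψ v ∧ HasSum (fun n : ℕ => b n *
      (-(2 * Real.pi * Complex.I) * (iteratedDeriv n ψ (polar σ d) / n.factorial))) v := by
  have key : ∀ dm dp : ℝ, θ - α / 2 < dm → dm < d → d < dp → dp < θ + α / 2 → _ :=
    fun dm dp ha hb' hc hd' =>
      (hψ dm dp ha hd').elim fun C hC =>
        jump_principalPart (dm := dm) (dp := dp) (s := σ) (y := d) (C := C) (ψ := ψ) hb hσ hb' hc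
          (by linarith) (fun r x hr hx1 hx2 => hd r x hr (by linarith) (by linarith)) hC
  -- One pair of directions fixes the value. Every other pair gives the sum of the same series,
  -- hence the same value.
  have h0 := (key ((θ - α / 2 + d) / 2) ((d + (θ + α / 2)) / 2) (by linarith) (by linarith)
    (by linarith) (by linarith)).2
  refine ⟨_, ⟨_, hG, fun dm dp ha hb' hc hd' => ?_⟩, h0⟩
  obtain ⟨hi, hs⟩ := key dm dp ha hb' hc hd'
  exact ⟨(hi dm le_rfl (by linarith) hb'.ne).1, (hi dp (by linarith) le_rfl hc.ne').1,
    hs.unique h0⟩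

/-! ### Derivatives of the Dirac function -/

lemma diracFunction_eq (m : ℕ) (c s : ℂ) :
    diracFunction m c s =
      -((-1) ^ m * m.factorial / (2 * Real.pi * Complex.I)) / (s - c) ^ (m + 1) := by
  have h : (fun s : ℂ => -1 / (2 * (Real.pi : ℂ) * Complex.I * (s - c))) =
      fun s => (-1 / (2 * (Real.pi : ℂ) * Complex.I)) * (1 * s - c)⁻¹ := by
    funext s
    rw [one_mul, div_mul_eq_div_div, div_eq_mul_inv _ (s - c)]
  rw [diracFunction, h, iteratedDeriv_const_mul_field, iteratedDeriv_eq_iterate,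
    iter_deriv_inv_linear_sub]
  simp only [one_pow, mul_one, one_mul]
  rw [show (-1 - (m : ℤ)) = -((m + 1 : ℕ) : ℤ) by push_cast; ring, zpow_neg, zpow_natCast]
  ring

lemma rapidDecay_single (n : ℕ) (v : ℂ) : RapidDecay (Pi.single n v) := fun M _ =>
  summable_of_ne_finset_zero (s := {n}) fun m hm => by
    rw [Pi.single_eq_of_ne (by simpa using hm)]; simp

lemma diracFunction_eq_principalPart (m : ℕ) (c : ℂ) :
    diracFunction m c =
      principalPart (Pi.single m (-((-1) ^ m * m.factorial / (2 * Real.pi * Complex.I)))) c := by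
  funext s
  rw [diracFunction_eq, principalPart, tsum_eq_single m, Pi.single_eq_same]
  intro n hn
  rw [Pi.single_eq_of_ne hn, zero_div]

/-! ### The jump of the `1`-sum -/

/-- The integrand splits into the principal part and `Q(w) + f(-w)`, both times the heat kernel;
only the first has a singularity between the directions `dm/2` and `dp/2`. The constant `κ` bounds
`cos(2x - ψ)` from below there, and `B < κ/(4τ)` makes the Gaussian decay beat the growth
`exp(B‖w‖²)`. -/
lemma HasPole.kSum_jump {f : ℂ → ℂ} {b : ℕ → ℂ} {Q : ℂ → ℂ} {A B σ y dm dp κ τ ψ : ℝ}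
    {F : PowerSeries ℂ} (h : HasPole f b (polar σ y) Q A B) (hF : IsHeatSeries f F) (hσ : 0 < σ)
    (hτ : 0 < τ) (h1 : dm < 2 * y) (h2 : 2 * y < dp) (hlt : dp - dm < Real.pi)
    (hcos : ∀ x, dm / 2 ≤ x → x ≤ dp / 2 → κ ≤ Real.cos (2 * x - ψ)) (hB : B < κ / (4 * τ)) :
    KSumConverges 1 dp F τ ψ ∧ KSumConverges 1 dm F τ ψ ∧
      HasSum (fun n : ℕ => b n * (-(2 * Real.pi * Complex.I) *
        (iteratedDeriv n (heatKernel τ ψ) (polar σ y) / n.factorial)))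
        (kSum 1 dp F τ ψ - kSum 1 dm F τ ψ) := by
  have hpi := Real.pi_pos
  have hdp : ((dp : ℝ) : Real.Angle) ≠ (2 * y : ℝ) := fun he => h2.ne' (eq_of_angle_eq he (by
    rw [abs_lt]; constructor <;> linarith))
  have hdm : ((dm : ℝ) : Real.Angle) ≠ (2 * y : ℝ) := fun he => h1.ne (eq_of_angle_eq he (by
    rw [abs_lt]; constructor <;> linarith))
  have hK : ∀ s, DifferentiableAt ℂ (heatKernel τ ψ) s := fun s =>
    (differentiable_heatKernel τ ψ).differentiableAt
  -- the kernel alone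
  have hKb : ∀ r x : ℝ, 0 < r → dm / 2 ≤ x → x ≤ dp / 2 → ‖heatKernel τ ψ (polar r x)‖ ≤
      1 * (Real.sqrt (4 * Real.pi) * Real.sqrt τ)⁻¹ * max 1 (κ / (4 * τ) - B)⁻¹ / (1 + r ^ 2) := by
    intro r x hr hx1 hx2
    have := norm_mul_heatKernel_le (g := 1) zero_le_one hτ hr.le (hcos x hx1 hx2) hB (by
      rw [norm_one, one_mul]
      exact Real.one_le_exp (by have := h.B_pos; positivity))
    rwa [one_mul] at this
  obtain ⟨hi, hsum⟩ := jump_principalPart h.rapid hσ (y := y) (dm := dm / 2) (dp := dp / 2)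
    (by linarith) (by linarith) (by linarith) (fun r x _ _ _ => hK _) hKb
  -- the remaining part is holomorphic between the two directions
  have hneg := h.comp_neg
  have hnot : ∀ r x : ℝ, 0 < r → dm / 2 ≤ x → x ≤ dp / 2 → polar r x ≠ -polar σ y := by
    intro r x hr hx1 hx2
    refine polar_ne_neg_polar hr.le hσ ?_
    rw [abs_lt]; constructor <;> linarith
  obtain ⟨c, hc, hdist⟩ := exists_dist_polar hneg.ne_zero hnot
  obtain ⟨A', hA', hfb⟩ := hneg.bound_of_dist hc
  have hHd : ∀ r x : ℝ, 0 < r → dm / 2 ≤ x → x ≤ dp / 2 →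
      DifferentiableAt ℂ (fun w => (Q w + f (-w)) * heatKernel τ ψ w) (polar r x) :=
    fun r x hr hx1 hx2 =>
      (h.entire.differentiableAt.add (hneg.differentiableAt (hnot r x hr hx1 hx2))).mul (hK _)
  have hHb : ∀ r x : ℝ, 0 < r → dm / 2 ≤ x → x ≤ dp / 2 →
      ‖(fun w => (Q w + f (-w)) * heatKernel τ ψ w) (polar r x)‖ ≤
      (A + A') * (Real.sqrt (4 * Real.pi) * Real.sqrt τ)⁻¹ * max 1 (κ / (4 * τ) - B)⁻¹ /
        (1 + r ^ 2) := by
    intro r x hr hx1 hx2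
    refine norm_mul_heatKernel_le (add_pos h.A_pos hA').le hτ hr.le (hcos x hx1 hx2) hB ?_
    rw [add_mul]
    exact (norm_add_le _ _).trans (add_le_add (h.bound _) (hfb _ (hdist r x hr.le hx1 hx2)))
  have hrot := rayIntegral_eq_of_differentiableAt (by linarith) hHd hHb
  have hsplit : ∀ x, dm / 2 ≤ x → x ≤ dp / 2 → x ≠ y →
      IntegrableOn (fun r => (f (polar r x) + f (-polar r x)) * heatKernel τ ψ (polar r x))
        (Ioi 0) ∧
      rayIntegral (fun w => (f w + f (-w)) * heatKernel τ ψ w) x =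
        rayIntegral (fun w => principalPart b (polar σ y) w * heatKernel τ ψ w) x +
        rayIntegral (fun w => (Q w + f (-w)) * heatKernel τ ψ w) x := by
    intro x hx1 hx2 hxy
    have hi1 := (hi x hx1 hx2 hxy).1
    have hi2 := integrableOn_comp_polar (fun r hr => hHd r x hr hx1 hx2)
      (fun r hr => hHb r x hr hx1 hx2)
    have he : ∀ r : ℝ, 0 < r → (f (polar r x) + f (-polar r x)) * heatKernel τ ψ (polar r x) =
        principalPart b (polar σ y) (polar r x) * heatKernel τ ψ (polar r x) +
          (Q (polar r x) + f (-polar r x)) * heatKernel τ ψ (polar r x) := by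
      intro r hr
      rw [h.eq (polar r x) (polar_ne_polar hr hσ hxy (by rw [abs_lt]; constructor <;> linarith))]
      ring
    constructor
    · exact (hi1.add hi2).congr_fun (fun r hr => (he r hr).symm) measurableSet_Ioi
    · rw [← rayIntegral_add hi1 hi2]
      exact rayIntegral_congr he
  obtain ⟨hip, hep⟩ := hsplit (dp / 2) (by linarith) le_rfl (by linarith)
  obtain ⟨him, hem⟩ := hsplit (dm / 2) le_rfl (by linarith) (by linarith)
  have hgp := fun r hr => h.continuedDeceleration_eq hF hσ hdp (r := r) hr
  have hgm := fun r hr => h.continuedDeceleration_eq hF hσ hdm (r := r) hr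
  refine ⟨kSumConverges_of_integrableOn hτ hgp hip, kSumConverges_of_integrableOn hτ hgm him, ?_⟩
  rw [kSum_eq_rayIntegral hτ hgp, kSum_eq_rayIntegral hτ hgm, hep, hem, hrot, add_sub_add_right_eq_sub]
  exact hsum

/-! ### The hyperfunction of a function with a pole -/

/-- Modulo functions that extend across the slit only the principal part is left: `Q` is entire, and
the pole `-p` of `f(-s)` lies outside the sector since `α < π` and outside the disc since `ρ ≤ σ`.
-/
lemma HasPole.exists_hyperfunction {f : ℂ → ℂ} {b : ℕ → ℂ} {Q : ℂ → ℂ} {A B θ α ρ σ d : ℝ}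
    (h : HasPole f b (polar σ d) Q A B) (hσ : 0 < σ) (hρ : ρ ≤ σ) (hα : α < Real.pi)
    (h1 : θ - α / 2 < d) (h2 : d < θ + α / 2) :
    ∃ F : LaplaceHyperfunction 2 θ α ρ d, IsDefiningFunction F (fun s => f s + f (-s)) ∧
      IsDefiningFunction F f ∧ IsDefiningFunction F (principalPart b (polar σ d)) := by
  have hslit := polar_notMem_slitSector (θ := θ) (α := α) (d := d) hσ hρ
  have hne : ∀ s ∈ slitSector θ α ρ d, s ≠ polar σ d := by
    rintro s hs rfl
    exact hslit hs
  have hpp := (h.rapid.hasPole h.ne_zero).expGrowth hslit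
  have hQ : ExpGrowth 2 (hatSector θ α ρ) Q := (h.remainder h.comp_neg.ne_zero).expGrowth
    (neg_polar_notMem_hatSector hσ hρ hα h1 h2)
  have hneg : ExpGrowth 2 (hatSector θ α ρ) fun w => f (-w) :=
    h.comp_neg.expGrowth (neg_polar_notMem_hatSector hσ hρ hα h1 h2)
  have hneg' : ExpGrowth 2 (slitSector θ α ρ d) fun w => f (-w) :=
    h.comp_neg.expGrowth fun hm =>
      neg_polar_notMem_hatSector (ρ := ρ) hσ hρ hα h1 h2 (slitSector_subset _ _ _ _ hm)
  have hf := h.expGrowth hslit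
  have hF : IsDefiningFunction (Submodule.Quotient.mk ⟨_, hpp⟩ : LaplaceHyperfunction 2 θ α ρ d)
      (principalPart b (polar σ d)) := ⟨hpp, rfl⟩
  refine ⟨_, ?_, ?_, hF⟩
  · refine isDefiningFunction_of_eqOn (h := fun s => Q s + f (-s)) hF
      ((expGrowthSpace 2 (slitSector θ α ρ d)).add_mem hf hneg')
      ((expGrowthSpace 2 (hatSector θ α ρ)).add_mem hQ hneg) fun s hs => ?_
    rw [h.eq s (hne s hs), add_assoc]
  · exact isDefiningFunction_of_eqOn hF hf hQ fun s hs => h.eq s (hne s hs)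

lemma isDefiningFunction_diracFunction {θ α ρ σ d : ℝ} (hσ : 0 < σ) (hρ : ρ ≤ σ) (m : ℕ) :
    ∃ G : LaplaceHyperfunction 2 θ α ρ d, IsDefiningFunction G (diracFunction m (polar σ d)) := by
  have : ExpGrowth 2 (slitSector θ α ρ d) (diracFunction m (polar σ d)) := by
    rw [diracFunction_eq_principalPart]
    exact ((rapidDecay_single _ _).hasPole (polar_ne_zero hσ d)).expGrowth
      (polar_notMem_slitSector hσ hρ)
  exact ⟨Submodule.Quotient.mk ⟨_, this⟩, this, rfl⟩

/-- A Dirac derivative is a principal part with a single nonzero coefficient, so its pairing is one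
term of the general formula. -/
lemma hasPairing_diracFunction {k θ α ρ σ d : ℝ} {G : LaplaceHyperfunction k θ α ρ d}
    {ψ : ℂ → ℂ} {m : ℕ} (hσ : 0 < σ) (hα : α < Real.pi)
    (h1 : θ - α / 2 < d) (h2 : d < θ + α / 2)
    (hG : IsDefiningFunction G (diracFunction m (polar σ d)))
    (hd : ∀ r x : ℝ, 0 ≤ r → θ - α / 2 < x → x < θ + α / 2 → DifferentiableAt ℂ ψ (polar r x))
    (hψ : ∀ β₁ β₂ : ℝ, θ - α / 2 < β₁ → β₂ < θ + α / 2 → ∃ C : ℝ,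
      ∀ r x : ℝ, 0 < r → β₁ ≤ x → x ≤ β₂ → ‖ψ (polar r x)‖ ≤ C / (1 + r ^ 2)) :
    HasPairing G ψ ((-1) ^ m * iteratedDeriv m ψ (polar σ d)) := by
  rw [diracFunction_eq_principalPart] at hG
  obtain ⟨v, hv, hs⟩ := hasPairing_principalPart (rapidDecay_single _ _) hσ hα h1 h2 hG hd hψ
  have h3 := hasSum_single (f := fun n : ℕ => (Pi.single m
      (-((-1) ^ m * m.factorial / (2 * Real.pi * Complex.I))) : ℕ → ℂ) n *
      (-(2 * Real.pi * Complex.I) * (iteratedDeriv n ψ (polar σ d) / n.factorial))) m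
    (fun n hn => by rw [Pi.single_eq_of_ne hn, zero_mul])
  have h4 := hs.unique h3
  convert! hv using 1
  rw [h4, Pi.single_eq_same]
  have hpi : (Real.pi : ℂ) ≠ 0 := Complex.ofReal_ne_zero.2 Real.pi_ne_zero
  have hfac : (m.factorial : ℂ) ≠ 0 := Nat.cast_ne_zero.2 m.factorial_ne_zero
  have hI := Complex.I_ne_zero
  field_simp

lemma ExpDecay.exists_bound {θ α ρ : ℝ} {ψ : ℂ → ℂ} (h : ExpDecay 2 (hatSector θ α ρ) ψ)
    {β₁ β₂ : ℝ} (h1 : θ - α / 2 < β₁) (h2 : β₂ < θ + α / 2) : ∃ C : ℝ,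
      ∀ r x : ℝ, 0 < r → β₁ ≤ x → x ≤ β₂ → ‖ψ (polar r x)‖ ≤ C / (1 + r ^ 2) := by
  obtain ⟨C₁, C₂, hC₁, hC₂, hb⟩ := h.2 β₁ β₂ fun r x hr hx1 hx2 =>
    Or.inr (polar_mem_sector hr (by linarith) (by linarith))
  refine ⟨C₁ * max 1 C₂⁻¹, fun r x hr hx1 hx2 => (hb r x hr hx1 hx2).trans ?_⟩
  rw [Real.rpow_two, mul_div_assoc]
  gcongr
  exact exp_neg_mul_sq_le hC₂ r

lemma ExpDecay.differentiableAt {θ α ρ : ℝ} {ψ : ℂ → ℂ} (h : ExpDecay 2 (hatSector θ α ρ) ψ)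
    (hρ : 0 < ρ) {r x : ℝ} (hr : 0 ≤ r) (h1 : θ - α / 2 < x) (h2 : x < θ + α / 2) :
    DifferentiableAt ℂ ψ (polar r x) := by
  refine h.1.differentiableAt ((isOpen_hatSector _ _ _).mem_nhds ?_)
  rcases hr.eq_or_lt with rfl | hr
  · rw [polar_zero]; exact Or.inl (Metric.mem_ball_self hρ)
  · exact Or.inr (polar_mem_sector hr h1 h2)

/-- In a sector on which `exp (-s² / (4t))` decreases, the heat kernel is bounded by a multiple of
`1 / (1 + r²)` on closed subsectors. -/
lemma heatKernel_exists_bound {θ α τ ψ β₁ β₂ : ℝ} (hτ : 0 < τ)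
    (hcos : ∀ x, θ - α / 2 < x → x < θ + α / 2 → 0 < Real.cos (2 * x - ψ))
    (h1 : θ - α / 2 < β₁) (h2 : β₂ < θ + α / 2) : ∃ C : ℝ,
      ∀ r x : ℝ, 0 < r → β₁ ≤ x → x ≤ β₂ → ‖heatKernel τ ψ (polar r x)‖ ≤ C / (1 + r ^ 2) := by
  rcases lt_or_ge β₂ β₁ with hβ | hβ
  · exact ⟨0, fun r x _ hx1 hx2 => by linarith⟩
  obtain ⟨x₀, hx₀, hmin⟩ := (isCompact_Icc (a := β₁) (b := β₂)).exists_isMinOn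
    ⟨β₁, by simp [hβ]⟩ (f := fun x => Real.cos (2 * x - ψ)) (by fun_prop)
  have hκ := hcos x₀ (by linarith [hx₀.1]) (by linarith [hx₀.2])
  refine ⟨1 * (Real.sqrt (4 * Real.pi) * Real.sqrt τ)⁻¹ *
    max 1 (Real.cos (2 * x₀ - ψ) / (4 * τ) - 0)⁻¹, fun r x hr hx1 hx2 => ?_⟩
  have := norm_mul_heatKernel_le (g := 1) (B := 0) zero_le_one hτ hr.le (hmin ⟨hx1, hx2⟩)
    (by positivity) (by simp)
  rwa [one_mul] at this

/-! ### The data of the heat equation -/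

lemma polar_argAt {z₀ z : ℂ} {θ : ℝ} (hz₀ : z₀ ≠ 0) (hθ : z₀ = polar ‖z₀‖ θ) :
    z₀ - z = polar ‖z₀ - z‖ (argAt z₀ θ z) := by
  have h1 := exists_eq_polar ((z₀ - z) / z₀)
  calc z₀ - z = z₀ * ((z₀ - z) / z₀) := (mul_div_cancel₀ _ hz₀).symm
    _ = polar ‖z₀‖ θ * polar ‖(z₀ - z) / z₀‖ (Complex.arg ((z₀ - z) / z₀)) := by rw [← hθ, ← h1]
    _ = _ := by
      rw [polar_mul, norm_div, mul_div_cancel₀ _ (norm_ne_zero_iff.2 hz₀), argAt]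

lemma exists_argAt_near {z₀ : ℂ} (hz₀ : z₀ ≠ 0) (θ : ℝ) {e : ℝ} (he : 0 < e) :
    ∃ r : ℝ, 0 < r ∧ ∀ z ∈ Metric.ball (0 : ℂ) r, |argAt z₀ θ z - θ| < e := by
  have hc : ContinuousAt (fun z : ℂ => Complex.arg ((z₀ - z) / z₀)) 0 := by
    refine ContinuousAt.comp (f := fun z : ℂ => (z₀ - z) / z₀) (Complex.continuousAt_arg ?_)
      (by fun_prop)
    rw [sub_zero, div_self hz₀]
    exact Complex.one_mem_slitPlane
  obtain ⟨r, hr, hb⟩ := Metric.continuousAt_iff.1 hc e he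
  refine ⟨r, hr, fun z hz => ?_⟩
  have := hb hz
  rw [sub_zero, div_self hz₀, Complex.arg_one, Real.dist_eq, sub_zero] at this
  rwa [argAt, add_sub_cancel_left]

/-- The recursion forces `u n = φ⁽²ⁿ⁾/n!` on the disc. The induction needs equality near each point,
because the next coefficient differentiates it. -/
lemma isHeatSeries_seriesAt {φ : ℂ → ℂ} {R : ℝ} {u : ℕ → ℂ → ℂ} (hu : IsFormalHeatSolution φ R u)
    {z : ℂ} (hz : ‖z‖ < R) : IsHeatSeries (fun w => φ (z + w)) (seriesAt u z) := by
  obtain ⟨-, h0, hrec⟩ := hu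
  have key : ∀ n : ℕ, ∀ z ∈ Metric.ball (0 : ℂ) R,
      u n z = (n.factorial : ℂ)⁻¹ * iteratedDeriv (2 * n) φ z := by
    intro n
    induction n with
    | zero => intro z hz; simpa using h0 z hz
    | succ n ih =>
      intro z hz
      have hev : u n =ᶠ[𝓝 z] fun z => (n.factorial : ℂ)⁻¹ * iteratedDeriv (2 * n) φ z := by
        filter_upwards [Metric.isOpen_ball.mem_nhds hz] with v hv using ih v hv
      have h1 := hrec n z hz
      have h2 : iteratedDeriv 2 (iteratedDeriv (2 * n) φ) = iteratedDeriv (2 * (n + 1)) φ := by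
        simp only [iteratedDeriv_eq_iterate]
        rw [← Function.iterate_add_apply, add_comm, mul_add, mul_one]
      rw [hev.iteratedDeriv_eq 2, iteratedDeriv_const_mul_field, h2] at h1
      have hn : (n : ℂ) + 1 ≠ 0 := Nat.cast_add_one_ne_zero n
      have hfac : (n.factorial : ℂ) ≠ 0 := Nat.cast_ne_zero.2 n.factorial_ne_zero
      rw [Nat.factorial_succ]
      push_cast
      field_simp at h1 ⊢
      linear_combination h1
  intro n
  rw [seriesAt, PowerSeries.coeff_mk, key n z (by simpa using hz), iteratedDeriv_comp_const_add]
  simp only [add_zero]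
  rw [div_eq_mul_inv, mul_comm]

/-- The growth rate `B` is chosen before `z`, which later allows one bound on `|t|` for all `z`.
This is possible because `‖z + w‖² ≤ 2‖z‖² + 2‖w‖²`: the term in `z` goes into `A`. -/
lemma exists_hasPole {z₀ : ℂ} {a : ℕ → ℂ} {Phi φ : ℂ → ℂ} (hPhi : ExpGrowth 2 univ Phi)
    (hφ : DifferentiableOn ℂ φ {z₀}ᶜ)
    (hsum : ∀ z : ℂ, 1 ≤ ‖z - z₀‖ →
      HasSum (fun n : ℕ => a (n + 1) / (z - z₀) ^ (n + 1)) (φ z - Phi z)) :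
    ∃ B : ℝ, ∀ z : ℂ, z ≠ z₀ → ∃ A : ℝ, HasPole (fun w => φ (z + w)) (fun n => a (n + 1)) (z₀ - z)
      (fun w => Phi (z + w)) A B := by
  obtain ⟨hd, hg⟩ := hPhi
  rw [differentiableOn_univ] at hd
  obtain ⟨hb, hall⟩ := hasSum_principalPart (hφ.sub hd.differentiableOn) hsum
  -- The directions from `-π` to `π` cover `ℂ ∖ {0}`; the value at `0` is absorbed into the
  -- constant.
  obtain ⟨C₁, C₂, hC₁, hC₂, hbd⟩ := hg (-Real.pi) Real.pi fun _ _ _ _ _ => mem_univ _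
  have hbd' : ∀ s : ℂ, ‖Phi s‖ ≤ max C₁ ‖Phi 0‖ * Real.exp (C₂ * ‖s‖ ^ 2) := by
    intro s
    rcases eq_or_ne s 0 with rfl | hs
    · simp
    · have := hbd ‖s‖ (Complex.arg s) (norm_pos_iff.2 hs) (Complex.neg_pi_lt_arg s).le
        (Complex.arg_le_pi s)
      rw [← exists_eq_polar, Real.rpow_two] at this
      refine this.trans ?_
      gcongr
      exact le_max_left _ _
  refine ⟨2 * C₂, fun z hz => ⟨max C₁ ‖Phi 0‖ * Real.exp (2 * C₂ * ‖z‖ ^ 2), ?_⟩⟩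
  refine ⟨sub_ne_zero.2 hz.symm, hb, by positivity, by positivity,
    hd.comp (differentiable_const z |>.add differentiable_id), fun w => ?_, fun w hw => ?_⟩
  · refine (hbd' (z + w)).trans ?_
    rw [mul_assoc, ← Real.exp_add]
    gcongr
    have h1 : ‖z + w‖ ^ 2 ≤ (‖z‖ + ‖w‖) ^ 2 := by gcongr; exact norm_add_le z w
    nlinarith [sq_nonneg (‖z‖ - ‖w‖)]
  · have hne : z + w ≠ z₀ := fun he => hw (by rw [← he]; ring)
    have h1 := (hall (z + w) hne).tsum_eq
    change principalPart _ _ _ = φ (z + w) - Phi (z + w) at h1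
    rw [← principalPart_translate, h1, sub_add_cancel]

end

/-! ### The Stokes line, the hyperfunction and the jump -/

theorem theorem1
    (z₀ : ℂ) (hz₀ : z₀ ≠ 0)
    -- `θ` is any value of `arg z₀`, and `δ = 2θ`
    (θ : ℝ) (hθ : z₀ = polar ‖z₀‖ θ)
    -- the coefficients `a₁, a₂, …` (the value `a 0` plays no role)
    (a : ℕ → ℂ) (ha : limsup (fun n : ℕ => ‖a n‖ₑ ^ (1 / (n : ℝ))) atTop < 1)
    (Phi : ℂ → ℂ) (hPhi : ExpGrowth 2 univ Phi)
    (φ : ℂ → ℂ) (hφ : DifferentiableOn ℂ φ {z₀}ᶜ)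
    (hsum : ∀ z : ℂ, 1 ≤ ‖z - z₀‖ →
      HasSum (fun n : ℕ => a (n + 1) / (z - z₀) ^ (n + 1)) (φ z - Phi z))
    (R : ℝ) (hR : 0 < R) (u : ℕ → ℂ → ℂ) (hu : IsFormalHeatSolution φ R u) :
    -- the Stokes line (for `z = 0` this is the direction `δ = 2θ`)
    ((∃ n : ℕ, 1 ≤ n ∧ a n ≠ 0) → ∀ z : ℂ, ‖z‖ < R → ‖z‖ < ‖z₀‖ →
      IsStokesLine 1 (2 * argAt z₀ θ z) (seriesAt u z)) ∧
    -- the hyperfunction `F_z`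
    (∀ α ρ : ℝ, 0 < α → α < Real.pi → 0 < ρ → ρ < ‖z₀‖ →
      ∃ r : ℝ, 0 < r ∧ ∀ z ∈ Metric.ball (0 : ℂ) r,
        z₀ - z ∈ sector θ α ∧
        ∃ (F : LaplaceHyperfunction 2 θ α ρ (argAt z₀ θ z))
          (Δ : ℕ → LaplaceHyperfunction 2 θ α ρ (argAt z₀ θ z)),
          IsDefiningFunction F (fun s => φ (s + z) + φ (z - s)) ∧
          IsDefiningFunction F (fun s => φ (s + z)) ∧
          IsDefiningFunction F (fun s => ∑' n : ℕ, a (n + 1) / (z + s - z₀) ^ (n + 1)) ∧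
          -- `Δ n` is the `n`-th derivative of the Dirac function at `s = z₀ - z`
          (∀ n, IsDefiningFunction (Δ n) (diracFunction n (z₀ - z))) ∧
          -- the expansion in terms of defining functions
          TendstoLocallyUniformlyOn
            (fun (N : ℕ) (s : ℂ) => -2 * (Real.pi : ℂ) * Complex.I *
              ∑ n ∈ Finset.range N,
                a (n + 1) * (-1) ^ n / (n.factorial : ℂ) * diracFunction n (z₀ - z) s)
            (fun s => ∑' n : ℕ, a (n + 1) / (z + s - z₀) ^ (n + 1)) atTop
            (slitSector θ α ρ (argAt z₀ θ z)) ∧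
          -- the expansion in terms of analytic functionals
          ∀ ψ : ℂ → ℂ, ExpDecay 2 (hatSector θ α ρ) ψ →
            (∀ n, HasPairing (Δ n) ψ ((-1) ^ n * iteratedDeriv n ψ (z₀ - z))) ∧
            ∃ v : ℂ, HasPairing F ψ v ∧
              HasSum (fun n : ℕ => -2 * (Real.pi : ℂ) * Complex.I *
                (a (n + 1) * (-1) ^ n / (n.factorial : ℂ) *
                  ((-1) ^ n * iteratedDeriv n ψ (z₀ - z)))) v) ∧
    -- the jump
    (∀ ε : ℝ, 0 < ε → ε < Real.pi → ∃ η : ℝ, 0 < η ∧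
      ∀ α ρ : ℝ, 0 < α → α ≤ ε / 2 → 0 < ρ → ρ < ‖z₀‖ →
      ∀ δp δm : ℝ, 2 * θ < δp → δp < 2 * θ + η → 2 * θ - η < δm → δm < 2 * θ →
      ∃ r : ℝ, 0 < r ∧ ∀ z ∈ Metric.ball (0 : ℂ) r,
        z₀ - z ∈ sector θ α ∧
        KSummable 1 δp (seriesAt u z) ∧ KSummable 1 δm (seriesAt u z) ∧
        ∃ F : LaplaceHyperfunction 2 θ α ρ (argAt z₀ θ z),
          IsDefiningFunction F (fun s => φ (s + z) + φ (z - s)) ∧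
          -- `t = τ e^{iψ}` in the sector in direction `δ` with opening `π - ε` and radius `r`
          ∀ τ ψ : ℝ, 0 < τ → τ < r →
            2 * θ - (Real.pi - ε) / 2 < ψ → ψ < 2 * θ + (Real.pi - ε) / 2 →
            KSumConverges 1 δp (seriesAt u z) τ ψ ∧ KSumConverges 1 δm (seriesAt u z) τ ψ ∧
            HasPairing F (heatKernel τ ψ)
              (kSum 1 δp (seriesAt u z) τ ψ - kSum 1 δm (seriesAt u z) τ ψ) ∧
            HasSum (fun n : ℕ => -Complex.I *
                ((Real.sqrt Real.pi : ℂ) / polar (Real.sqrt τ) (ψ / 2)) *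
                (a (n + 1) / (n.factorial : ℂ) *
                  iteratedDeriv n (fun s : ℂ => Complex.exp (-s ^ 2 / (4 * polar τ ψ))) (z₀ - z)))
              (kSum 1 δp (seriesAt u z) τ ψ - kSum 1 δm (seriesAt u z) τ ψ)) := by
  obtain ⟨B, hpole⟩ := exists_hasPole hPhi hφ hsum
  have hpi := Real.pi_pos
  have hne : ∀ z : ℂ, ‖z‖ < ‖z₀‖ → z ≠ z₀ := by
    rintro z hz rfl
    exact lt_irrefl _ hz
  have hpol : ∀ z, z₀ - z = polar ‖z₀ - z‖ (argAt z₀ θ z) := fun z => polar_argAt hz₀ hθ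
  have hσ : ∀ z, ‖z‖ < ‖z₀‖ → 0 < ‖z₀ - z‖ := fun z hz =>
    norm_pos_iff.2 (sub_ne_zero.2 (hne z hz).symm)
  have hpole' : ∀ z, ‖z‖ < ‖z₀‖ → ∃ A : ℝ, HasPole (fun w => φ (z + w)) (fun n => a (n + 1))
      (polar ‖z₀ - z‖ (argAt z₀ θ z)) (fun w => Phi (z + w)) A B := by
    intro z hz
    rw [← hpol]
    exact hpole z (hne z hz)
  have hdist : ∀ (z : ℂ) (ρ : ℝ), ‖z‖ < ‖z₀‖ - ρ → ρ ≤ ‖z₀ - z‖ := fun z ρ hz => by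
    have := norm_sub_norm_le z₀ z
    linarith
  refine ⟨?_, ?_, ?_⟩
  · rintro ⟨n, hn, han⟩ z hzR hz
    obtain ⟨A, h⟩ := hpole' z hz
    have hF := isHeatSeries_seriesAt hu hzR
    -- Modulo `2π` there is at most one singular direction.
    refine ⟨(finite_singleton ((2 * argAt z₀ θ z : ℝ) : Real.Angle)).subset ?_, fun hs => ?_⟩
    · rintro β ⟨x, rfl, hx⟩
      by_contra hne'
      exact hx ⟨_, h.isContinuedDeceleration hF (hσ z hz) hne'⟩
    · have hb := congrFun (h.eq_zero_of_kSummable hF (hσ z hz) hs) (n - 1)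
      simp only [Nat.sub_add_cancel hn] at hb
      exact han hb
  · intro α ρ hα hαpi hρ hρz
    obtain ⟨r, hr, harg⟩ := exists_argAt_near hz₀ θ (half_pos hα)
    -- The first bound keeps `z₀ - z` in the sector, the second keeps it out of the disc of radius
    -- `ρ`.
    refine ⟨min r (‖z₀‖ - ρ), lt_min hr (by linarith), fun z hz => ?_⟩
    have hzr : ‖z‖ < min r (‖z₀‖ - ρ) := by simpa using hz
    have hzρ := hzr.trans_le (min_le_right _ _)
    have hz₁ : ‖z‖ < ‖z₀‖ := by linarith
    have hd := abs_lt.1 (harg z (by simpa using hzr.trans_le (min_le_left _ _)))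
    have h1 : θ - α / 2 < argAt z₀ θ z := by linarith
    have h2 : argAt z₀ θ z < θ + α / 2 := by linarith
    obtain ⟨A, h⟩ := hpole' z hz₁
    obtain ⟨F, hF1, hF2, hF3⟩ := h.exists_hyperfunction (hσ z hz₁) (hdist z ρ hzρ) hαpi h1 h2
    choose Δ hΔ using fun n => isDefiningFunction_diracFunction (θ := θ) (α := α)
      (d := argAt z₀ θ z) (hσ z hz₁) (hdist z ρ hzρ) n
    have hpp : (fun s => ∑' n : ℕ, a (n + 1) / (z + s - z₀) ^ (n + 1)) =
        principalPart (fun n => a (n + 1)) (z₀ - z) := by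
      funext s
      rw [← principalPart_translate, principalPart]
    refine ⟨hpol z ▸ polar_mem_sector (hσ z hz₁) h1 h2, F, Δ, ?_, ?_, ?_, ?_, ?_, ?_⟩
    · simpa only [add_comm, sub_eq_add_neg] using hF1
    · simpa only [add_comm] using hF2
    · rw [hpp, hpol z]; exact hF3
    · intro n; rw [hpol z]; exact hΔ n
    · rw [hpp]
      refine ((h.rapid.tendstoLocallyUniformlyOn (z₀ - z)).mono ?_).congr fun N s hs => ?_
      · intro s hs hs'
        rw [mem_singleton_iff.1 hs', hpol z] at hs
        exact polar_notMem_slitSector (hσ z hz₁) (hdist z ρ hzρ) hs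
      · simp only [Finset.mul_sum]
        refine Finset.sum_congr rfl fun n _ => ?_
        rw [diracFunction_eq]
        have hpi' : (Real.pi : ℂ) ≠ 0 := Complex.ofReal_ne_zero.2 Real.pi_ne_zero
        have hfac : (n.factorial : ℂ) ≠ 0 := Nat.cast_ne_zero.2 n.factorial_ne_zero
        have hI := Complex.I_ne_zero
        have hsign : ((-1 : ℂ) ^ n) * (-1) ^ n = 1 := by rw [← mul_pow]; norm_num
        have hpole : -2 * (Real.pi : ℂ) * Complex.I * (a (n + 1) * (-1) ^ n / n.factorial *
            (-((-1) ^ n * n.factorial / (2 * Real.pi * Complex.I)) / (s - (z₀ - z)) ^ (n + 1))) =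
            a (n + 1) * ((-1) ^ n * (-1) ^ n) / (s - (z₀ - z)) ^ (n + 1) := by
          field_simp
        rw [hpole, hsign, mul_one]
    · intro ψ hψ
      have hψd := fun r x hr hx1 hx2 => hψ.differentiableAt hρ (r := r) (x := x) hr hx1 hx2
      have hψb := fun β₁ β₂ hβ₁ hβ₂ => hψ.exists_bound (β₁ := β₁) (β₂ := β₂) hβ₁ hβ₂
      obtain ⟨v, hv, hs⟩ := hasPairing_principalPart h.rapid (hσ z hz₁) hαpi h1 h2 hF3 hψd hψb
      refine ⟨fun n => ?_, v, hv, hs.congr_fun fun n => ?_⟩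
      · rw [hpol z]
        exact hasPairing_diracFunction (hσ z hz₁) hαpi h1 h2 (hΔ n) hψd hψb
      · rw [← hpol z]
        have hsign : ((-1 : ℂ) ^ n) * (-1) ^ n = 1 := by rw [← mul_pow]; norm_num
        linear_combination (-2 * Real.pi * Complex.I * a (n + 1) / n.factorial *
          iteratedDeriv n ψ (z₀ - z)) * hsign
  · intro ε hε hεpi
    -- For `2x` between `δm` and `δp` one has `|2x - ψ| < ε/4 + (π - ε)/2 = π/2 - ε/4`, so the
    -- cosine is at least `sin (ε/4)`, uniformly in `t`.
    refine ⟨ε / 4, by positivity, fun α ρ hα hαε hρ hρz δp δm hp1 hp2 hm1 hm2 => ?_⟩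
    have hκ : 0 < Real.sin (ε / 4) := Real.sin_pos_of_pos_of_lt_pi (by linarith) (by linarith)
    -- Besides keeping `z₀ - z` in the sector, this ensures `δm < 2 * argAt z₀ θ z < δp`.
    obtain ⟨r, hr, harg⟩ := exists_argAt_near hz₀ θ
      (lt_min (half_pos hα) (lt_min (half_pos (sub_pos.2 hp1)) (half_pos (sub_pos.2 hm2))))
    have hB : 0 < B := by
      obtain ⟨A, h⟩ := hpole' 0 (by simpa using hz₀)
      exact h.B_pos
    -- The same radius bounds `z` and `t`. The last term is the condition `B < sin(ε/4)/(4τ)`, under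
    -- which the heat kernel dominates the growth of `φ`.
    refine ⟨min (min r R) (min (‖z₀‖ - ρ) (Real.sin (ε / 4) / (4 * B))),
      lt_min (lt_min hr hR) (lt_min (by linarith) (by positivity)), fun z hz => ?_⟩
    have hzr : ‖z‖ < min (min r R) (min (‖z₀‖ - ρ) (Real.sin (ε / 4) / (4 * B))) := by
      simpa using hz
    obtain ⟨⟨hzr, hzR⟩, hzρ, -⟩ := by simpa only [lt_min_iff] using hzr
    have hz₁ : ‖z‖ < ‖z₀‖ := by linarith
    have hd := harg z (by simpa using hzr)
    simp only [lt_min_iff, abs_lt] at hd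
    obtain ⟨hd1, hd2, hd3⟩ := hd
    have h1 : θ - α / 2 < argAt z₀ θ z := by linarith
    have h2 : argAt z₀ θ z < θ + α / 2 := by linarith
    obtain ⟨A, h⟩ := hpole' z hz₁
    have hS := isHeatSeries_seriesAt hu hzR
    obtain ⟨F, hF1, hF2, hF3⟩ :=
      h.exists_hyperfunction (hσ z hz₁) (hdist z ρ hzρ) (by linarith) h1 h2
    have hang : ∀ x : ℝ, x ≠ 2 * argAt z₀ θ z → |x - 2 * argAt z₀ θ z| < Real.pi →
        KSummable 1 x (seriesAt u z) := fun x hx hx' =>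
      ⟨_, h.isContinuedDeceleration hS (hσ z hz₁)
        fun he => hx (eq_of_angle_eq he (by linarith))⟩
    refine ⟨hpol z ▸ polar_mem_sector (hσ z hz₁) h1 h2,
      hang δp (by linarith) (by rw [abs_lt]; constructor <;> linarith),
      hang δm (by linarith) (by rw [abs_lt]; constructor <;> linarith), F, ?_, ?_⟩
    · simpa only [add_comm, sub_eq_add_neg] using hF1
    intro τ ψ hτ hτr hψ1 hψ2
    have hτB : τ < Real.sin (ε / 4) / (4 * B) :=
      hτr.trans_le ((min_le_right _ _).trans (min_le_right _ _))
    obtain ⟨hcp, hcm, hs⟩ := h.kSum_jump (dm := δm) (dp := δp) (κ := Real.sin (ε / 4)) (ψ := ψ)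
      hS (hσ z hz₁) hτ (by linarith) (by linarith) (by linarith) (fun x hx1 hx2 => by
        rw [← Real.cos_pi_div_two_sub, ← Real.cos_abs (2 * x - ψ)]
        refine Real.cos_le_cos_of_nonneg_of_le_pi (abs_nonneg _) (by linarith) ?_
        rw [abs_le]; constructor <;> linarith) (by
        rw [lt_div_iff₀ (by positivity)] at hτB ⊢
        linarith)
    -- On the whole sector `|2x - ψ| < α + (π - ε)/2 ≤ π/2`, because `α ≤ ε/2`. So the heat kernel
    -- decays on closed subsectors and is an admissible test function.
    obtain ⟨v, hv, hs'⟩ := hasPairing_principalPart h.rapid (hσ z hz₁) (by linarith) h1 h2 hF3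
      (fun r x _ _ _ => (differentiable_heatKernel τ ψ).differentiableAt)
      (fun β₁ β₂ hβ₁ hβ₂ => heatKernel_exists_bound hτ (fun x hx1 hx2 =>
        Real.cos_pos_of_mem_Ioo ⟨by linarith, by linarith⟩) hβ₁ hβ₂)
    -- The jump and the value of the hyperfunction are sums of the same series. The constant of the
    -- final form comes from `-2πi/√(4π) = -i√π`.
    refine ⟨hcp, hcm, hs.unique hs' ▸ hv, hs.congr_fun fun n => ?_⟩
    have hP : polar (Real.sqrt τ) (ψ / 2) ≠ 0 := polar_ne_zero (Real.sqrt_pos.2 hτ) _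
    have hsq : (Real.sqrt Real.pi : ℂ) ^ 2 = Real.pi := by
      rw [← Complex.ofReal_pow, Real.sq_sqrt hpi.le]
    have hsq0 : (Real.sqrt Real.pi : ℂ) ≠ 0 := by
      rw [Ne, Complex.ofReal_eq_zero]; positivity
    have h4 : Real.sqrt (4 * Real.pi) = 2 * Real.sqrt Real.pi := by
      rw [Real.sqrt_mul (by norm_num), show (4 : ℝ) = 2 ^ 2 by norm_num,
        Real.sqrt_sq (by norm_num)]
    have hK : heatKernel τ ψ = fun s =>
        1 / ((Real.sqrt (4 * Real.pi) : ℂ) * polar (Real.sqrt τ) (ψ / 2)) *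
          Complex.exp (-s ^ 2 / (4 * polar τ ψ)) := rfl
    have hfac : (n.factorial : ℂ) ≠ 0 := Nat.cast_ne_zero.2 n.factorial_ne_zero
    rw [hK, iteratedDeriv_const_mul_field, ← hpol z, h4, ← hsq]
    push_cast
    field_simp
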